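/- Elements of $\mathrm{GF}(2^m)=\mathbb F_2[x]/(f)$, with $f$ irreducible of degree $m$, are stored in $m$-bit registers by their coefficients in the basis $1,x,\dots,x^{m-1}$. Circuits consist of CNOT and Toffoli gates. For every real $K$ there is a constant $C$, depending only on $K$, such that the following holds for every integer $m\ge 3$ and every irreducible polynomial over $\mathbb F_2$ of the form $f=x^m+g(x)$ with $\deg g<m$ and $\deg g\le K\log m$ (for instance $f=x^m+x+1+x^{2l_k}+\dots+x^{2l_1}$ with $1\le l_k<\dots<l_1$, $2l_1<m$ and $\max(1,2l_1)\le K\log m$). 1. The in-place multiplication $|a\rangle\mapsto|(1+x^{\lceil m/2\rceil})\,a\rangle$ in $\mathbb F_2[x]/(f)$ is implemented by an ancilla-free circuit of at most $C\,m\log m$ CNOT gates and no other gates. 2. The in-place squaring $|a\rangle\mapsto|a^2\rangle$ in $\mathbb F_2[x]/(f)$ is implemented by an ancilla-free circuit of at most $C\,m\log m$ CNOT gates and no other gates. 3. The division $|a,b,c\rangle|0^k\rangle\mapsto|a,b,c+a/b\rangle|0^k\rangle$ in $\mathbb F_2[x]/(f)$, where $a/0:=0$, is implemented for some $k\le C\,m\log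 m$ by a circuit with at most $C\,m^2\log\log m/\log m$ CNOT gates and at most $C\,m^{\log_2 3}\log m$ Toffoli gates. -/

import Mathlib

open Polynomial

/-- A gate of a reversible circuit over the wires `W`: a CNOT with control `c` and target `t`, or a
Toffoli with controls `c₁`, `c₂` and target `t`.  The wires of one gate are pairwise distinct. -/
inductive RevGate (W : Type) : Type
  | cnot (c t : W) (h : c ≠ t) : RevGate W
  | toffoli (c₁ c₂ t : W) (h₁₂ : c₁ ≠ c₂) (h₁ : c₁ ≠ t) (h₂ : c₂ ≠ t) : RevGate W

namespace RevGate

variable {W : Type}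

/-- Whether the gate is a CNOT. -/
def isCnot : RevGate W → Bool
  | cnot _ _ _ => true
  | toffoli _ _ _ _ _ _ => false

/-- Whether the gate is a Toffoli. -/
def isToffoli : RevGate W → Bool
  | cnot _ _ _ => false
  | toffoli _ _ _ _ _ _ => true

/-- The action of a gate on a computational basis state, i.e. on an assignment of bits to wires:
CNOT replaces the target bit `t` by `t + c`, Toffoli replaces it by `t + c₁ c₂`. -/
def apply [DecidableEq W] : RevGate W → (W → ZMod 2) → (W → ZMod 2)
  | cnot c t _, v => Function.update v t (v t + v c)
  | toffoli c₁ c₂ t _ _ _, v => Function.update v t (v t + v c₁ * v c₂)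

end RevGate

/-- A reversible circuit: a finite sequence of gates, the head of the list being applied first. -/
abbrev RevCircuit (W : Type) : Type := List (RevGate W)

namespace RevCircuit

variable {W : Type}

/-- The action of a circuit on computational basis states. -/
def eval [DecidableEq W] (Q : RevCircuit W) (v : W → ZMod 2) : W → ZMod 2 :=
  Q.foldl (fun u g => g.apply u) v

/-- The number of CNOT gates. -/
def cnotCount (Q : RevCircuit W) : ℕ := Q.countP RevGate.isCnot

/-- The number of Toffoli gates. -/
def toffoliCount (Q : RevCircuit W) : ℕ := Q.countP RevGate.isToffoli

end RevCircuit

noncomputable section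

/-- The element `v₀ + v₁ x + ⋯ + v_{m-1} x^{m-1}` of `𝔽₂[x]/(f)` that is stored in an `m`-bit
register with contents `v`.  If `f` has degree `m`, every element is stored in exactly one way. -/
def fieldElem (f : (ZMod 2)[X]) {m : ℕ} (v : Fin m → ZMod 2) : AdjoinRoot f :=
  ∑ i : Fin m, AdjoinRoot.of f (v i) * AdjoinRoot.root f ^ (i : ℕ)

/-- `Q` is an ancilla-free circuit that consists of CNOT gates only and maps `|a⟩` to `|F a⟩` in
place, for every `a ∈ 𝔽₂[x]/(f)`. -/
def CnotImplements (f : (ZMod 2)[X]) (m : ℕ) (F : AdjoinRoot f → AdjoinRoot f)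
    (Q : RevCircuit (Fin m)) : Prop :=
  Q.toffoliCount = 0 ∧ ∀ v : Fin m → ZMod 2, fieldElem f (Q.eval v) = F (fieldElem f v)

/-- The wires of a division circuit: three `m`-bit registers (dividend, divisor, target) and `k`
ancillae. -/
abbrev DivWires (m k : ℕ) : Type := Fin m ⊕ Fin m ⊕ Fin m ⊕ Fin k

/-- The basis state `|a, b, c, 0^k⟩`. -/
def divState {m : ℕ} (k : ℕ) (a b c : Fin m → ZMod 2) : DivWires m k → ZMod 2 :=
  Sum.elim a (Sum.elim b (Sum.elim c (fun _ => 0)))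

/-- `Q` performs division in the field `𝔽₂[x]/(f)`: it maps `|a, b, c, 0^k⟩` to
`|a, b, c + a/b, 0^k⟩`, where `a/0 = 0`. -/
def ImplementsDivision (f : (ZMod 2)[X]) [Fact (Irreducible f)] (m k : ℕ)
    (Q : RevCircuit (DivWires m k)) : Prop :=
  ∀ a b c : Fin m → ZMod 2, ∃ d : Fin m → ZMod 2,
    fieldElem f d = fieldElem f c + fieldElem f a / fieldElem f b ∧
      Q.eval (divState k a b c) = divState k a b d

end

/-! Write d for the degree of g. The first two items concern invertible linear maps over 𝔽₂. Since
x^m = g, the reduction of x^k with k < 2m only involves exponents congruent to k + t modulo m with 0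
≤ t ≤ 2d, provided 2d ≤ m (`coeff_root_pow`). With the wires ordered by laying a cycle flat on a
line (`foldCycle`), multiplication by 1 + x^⌈m/2⌉ becomes a band matrix of width O(d + 1), and so
does squaring after a permutation of the wires. Gaussian elimination stays inside such a band, so it
costs O(d + 1) CNOT gates per row (`mulVec_of_band`), in total O(m log m).

Division uses b⁻¹ = b^(2^m - 2) and the Itoh–Tsujii chain of powers b^(2^e - 1), in which e is
halved down from m - 1. This takes O(log m) multiplications, and one power a ↦ a^(2^e) per halving.
Products are computed by a Karatsuba recursion without ancillae (`add_reg_mul`) and reduced through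
scratch wires with arbitrary contents. The map a ↦ a^(2^k) is linear, so it can be done by k
squarings, at cost O(k m log m), or by the method of the four Russians, at cost O(m²/log m) for
every k. For k ≈ m/2^(i+1) the second bound is used for the first 2 log₂ log m values of i or so,
and the first bound sums geometrically to O(m²/log m) over the rest (`pow_cost_sum_le`). This yields
m² log log m / log m; the CNOT gates of the products are of lower order. After the quotient has been
added to the target, the inverse circuit clears all intermediate registers. -/

/-! ### Gates, circuits, and the transformations they realize with given costs. -/

namespace RevGate

variable {W W' : Type}

/-- All wires of the gate lie in `S`. -/
def Within (S : Set W) : RevGate W → Prop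
  | cnot c t _ => c ∈ S ∧ t ∈ S
  | toffoli c₁ c₂ t _ _ _ => c₁ ∈ S ∧ c₂ ∈ S ∧ t ∈ S

theorem Within.mono {S T : Set W} (h : S ⊆ T) {g : RevGate W} (hg : g.Within S) : g.Within T := by
  cases g with
  | cnot c t _ => exact ⟨h hg.1, h hg.2⟩
  | toffoli c₁ c₂ t _ _ _ => exact ⟨h hg.1, h hg.2.1, h hg.2.2⟩

/-- Relabelling of the wires of a gate. -/
def map (e : W ↪ W') : RevGate W → RevGate W'
  | cnot c t h => cnot (e c) (e t) (e.injective.ne h)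
  | toffoli c₁ c₂ t h₁₂ h₁ h₂ => toffoli (e c₁) (e c₂) (e t) (e.injective.ne h₁₂)
      (e.injective.ne h₁) (e.injective.ne h₂)

theorem map_within (e : W ↪ W') (g : RevGate W) : (g.map e).Within (Set.range e) := by
  cases g <;> simp [map, Within]

theorem exists_map_eq (e : W ↪ W') (g : RevGate W') (hg : g.Within (Set.range e)) :
    ∃ g' : RevGate W, g'.map e = g := by
  cases g with
  | cnot c t h =>
    obtain ⟨⟨c, rfl⟩, ⟨t, rfl⟩⟩ := hg
    exact ⟨cnot c t fun h' => h (congrArg e h'), rfl⟩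
  | toffoli c₁ c₂ t h₁₂ h₁ h₂ =>
    obtain ⟨⟨c₁, rfl⟩, ⟨c₂, rfl⟩, ⟨t, rfl⟩⟩ := hg
    exact ⟨toffoli c₁ c₂ t (fun h' => h₁₂ (congrArg e h')) (fun h' => h₁ (congrArg e h'))
      (fun h' => h₂ (congrArg e h')), rfl⟩

theorem isCnot_map (e : W ↪ W') (g : RevGate W) : (g.map e).isCnot = g.isCnot := by
  cases g <;> rfl

theorem isToffoli_map (e : W ↪ W') (g : RevGate W) : (g.map e).isToffoli = g.isToffoli := by
  cases g <;> rfl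

theorem apply_map_apply [DecidableEq W] [DecidableEq W'] (e : W ↪ W') (g : RevGate W)
    (v : W' → ZMod 2) (w : W) : (g.map e).apply v (e w) = g.apply (v ∘ e) w := by
  cases g <;> simp [map, apply, Function.update_apply]

theorem apply_map_of_notMem [DecidableEq W'] (e : W ↪ W') (g : RevGate W)
    (v : W' → ZMod 2) (w : W') (hw : w ∉ Set.range e) : (g.map e).apply v w = v w := by
  have h : ∀ x, w ≠ e x := fun x hx => hw ⟨x, hx.symm⟩
  cases g <;> simp [map, apply, h]

theorem apply_apply [DecidableEq W] (g : RevGate W) (v : W → ZMod 2) :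
    g.apply (g.apply v) = v := by
  funext w
  cases g with
  | cnot c t h =>
    by_cases hw : w = t
    · subst hw; simp [apply, h, add_assoc, CharTwo.add_self_eq_zero]
    · simp [apply, hw]
  | toffoli c₁ c₂ t h₁₂ h₁ h₂ =>
    by_cases hw : w = t
    · subst hw; simp [apply, h₁, h₂, add_assoc, CharTwo.add_self_eq_zero]
    · simp [apply, hw]

end RevGate

namespace RevCircuit

variable {W W' : Type}

@[simp] theorem eval_nil [DecidableEq W] (v : W → ZMod 2) : eval ([] : RevCircuit W) v = v := rfl

@[simp] theorem eval_cons [DecidableEq W] (g : RevGate W) (Q : RevCircuit W) (v : W → ZMod 2) :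
    eval (g :: Q) v = eval Q (g.apply v) := rfl

theorem eval_append [DecidableEq W] (Q R : RevCircuit W) (v : W → ZMod 2) :
    eval (Q ++ R) v = eval R (eval Q v) := by
  simp [eval, List.foldl_append]

theorem eval_reverse_eval [DecidableEq W] (Q : RevCircuit W) (v : W → ZMod 2) :
    eval Q.reverse (eval Q v) = v := by
  induction Q generalizing v with
  | nil => rfl
  | cons g Q ih => simp [eval_append, ih, RevGate.apply_apply]

theorem eval_eval_reverse [DecidableEq W] (Q : RevCircuit W) (v : W → ZMod 2) :
    eval Q (eval Q.reverse v) = v := by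
  simpa using eval_reverse_eval Q.reverse v

theorem eval_map_apply [DecidableEq W] [DecidableEq W'] (e : W ↪ W') (Q : RevCircuit W)
    (v : W' → ZMod 2) (w : W) :
    eval (Q.map (RevGate.map e)) v (e w) = eval Q (v ∘ e) w := by
  induction Q generalizing v with
  | nil => rfl
  | cons g Q ih =>
    simp only [List.map_cons, eval_cons, ih]
    congr 1
    funext x
    exact RevGate.apply_map_apply e g v x

theorem eval_map_of_notMem [DecidableEq W'] (e : W ↪ W') (Q : RevCircuit W)
    (v : W' → ZMod 2) (w : W') (hw : w ∉ Set.range e) :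
    eval (Q.map (RevGate.map e)) v w = v w := by
  induction Q generalizing v with
  | nil => rfl
  | cons g Q ih => simp [ih, RevGate.apply_map_of_notMem e g v w hw]

theorem exists_map_eq (e : W ↪ W') (Q : RevCircuit W') (hQ : ∀ g ∈ Q, g.Within (Set.range e)) :
    ∃ Q' : RevCircuit W, Q'.map (RevGate.map e) = Q := by
  induction Q with
  | nil => exact ⟨[], rfl⟩
  | cons g Q ih =>
    obtain ⟨g', rfl⟩ := g.exists_map_eq e (hQ g (by simp))
    obtain ⟨Q', rfl⟩ := ih fun g hg => hQ g (by simp [hg])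
    exact ⟨g' :: Q', rfl⟩

theorem cnotCount_map (e : W ↪ W') (Q : RevCircuit W) :
    cnotCount (Q.map (RevGate.map e)) = cnotCount Q := by
  simp only [cnotCount, List.countP_map]
  congr 1
  funext g
  exact g.isCnot_map e

theorem toffoliCount_map (e : W ↪ W') (Q : RevCircuit W) :
    toffoliCount (Q.map (RevGate.map e)) = toffoliCount Q := by
  simp only [toffoliCount, List.countP_map]
  congr 1
  funext g
  exact g.isToffoli_map e

end RevCircuit

/-- The transformation `F` of the basis states is performed by a circuit on the wires in `S` that
has at most `c` CNOT gates and at most `t` Toffoli gates. -/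
def Realizes {W : Type} [DecidableEq W] (S : Set W) (F : (W → ZMod 2) → (W → ZMod 2))
    (c t : ℕ) : Prop :=
  ∃ Q : RevCircuit W, (∀ g ∈ Q, g.Within S) ∧ (∀ v, Q.eval v = F v) ∧ Q.cnotCount ≤ c ∧
    Q.toffoliCount ≤ t

namespace Realizes

variable {W W' : Type} [DecidableEq W] [DecidableEq W'] {S T : Set W}
  {F G : (W → ZMod 2) → (W → ZMod 2)} {c t c' t' : ℕ}

theorem mono (h : Realizes S F c t) (hS : S ⊆ T) (hc : c ≤ c') (ht : t ≤ t') :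
    Realizes T F c' t' := by
  obtain ⟨Q, h1, h2, h3, h4⟩ := h
  exact ⟨Q, fun g hg => (h1 g hg).mono hS, h2, h3.trans hc, h4.trans ht⟩

theorem congr (h : Realizes S F c t) (hFG : ∀ v, G v = F v) : Realizes S G c t := by
  rwa [show G = F from funext hFG]

theorem of_id (h : ∀ v, F v = v) : Realizes S F 0 0 :=
  ⟨[], by simp, fun v => (h v).symm, by simp [RevCircuit.cnotCount],
    by simp [RevCircuit.toffoliCount]⟩

theorem comp (hG : Realizes S G c' t') (hF : Realizes S F c t) :
    Realizes S (fun v => G (F v)) (c + c') (t + t') := by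
  obtain ⟨Q, h1, h2, h3, h4⟩ := hF
  obtain ⟨R, k1, k2, k3, k4⟩ := hG
  refine ⟨Q ++ R, ?_, ?_, ?_, ?_⟩
  · intro g hg
    rcases List.mem_append.1 hg with hg | hg
    exacts [h1 g hg, k1 g hg]
  · intro v
    rw [RevCircuit.eval_append, h2, k2]
  · simp only [RevCircuit.cnotCount, List.countP_append] at *
    omega
  · simp only [RevCircuit.toffoliCount, List.countP_append] at *
    omega

/-- Every gate is an involution, so the reversed gate list inverts the circuit at the same cost. -/
theorem exists_inverse (hF : Realizes S F c t) :
    ∃ G, Realizes S G c t ∧ (∀ v, G (F v) = v) ∧ ∀ v, F (G v) = v := by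
  obtain ⟨Q, h1, h2, h3, h4⟩ := hF
  refine ⟨RevCircuit.eval Q.reverse, ⟨Q.reverse, ?_, fun _ => rfl, ?_, ?_⟩, ?_, ?_⟩
  · simpa using h1
  · simpa [RevCircuit.cnotCount] using h3
  · simpa [RevCircuit.toffoliCount] using h4
  · intro v
    rw [← h2, RevCircuit.eval_reverse_eval]
  · intro v
    rw [← h2, RevCircuit.eval_eval_reverse]

theorem add_single {a b : W} (ha : a ∈ S) (hb : b ∈ S) (hab : a ≠ b) :
    Realizes S (fun v => v + Pi.single b (v a)) 1 0 := by
  refine ⟨[.cnot a b hab], by simp [RevGate.Within, ha, hb], ?_,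
    by simp [RevCircuit.cnotCount, RevGate.isCnot],
    by simp [RevCircuit.toffoliCount, RevGate.isToffoli]⟩
  intro v
  funext w
  by_cases hw : w = b
  · subst hw; simp [RevGate.apply]
  · simp [RevGate.apply, hw]

theorem add_single_mul {a b d : W} (ha : a ∈ S) (hb : b ∈ S) (hd : d ∈ S) (hab : a ≠ b)
    (had : a ≠ d) (hbd : b ≠ d) :
    Realizes S (fun v => v + Pi.single d (v a * v b)) 0 1 := by
  refine ⟨[.toffoli a b d hab had hbd], by simp [RevGate.Within, ha, hb, hd], ?_,
    by simp [RevCircuit.cnotCount, RevGate.isCnot],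
    by simp [RevCircuit.toffoliCount, RevGate.isToffoli]⟩
  intro v
  funext w
  by_cases hw : w = d
  · subst hw; simp [RevGate.apply]
  · simp [RevGate.apply, hw]

theorem map (e : W ↪ W') (hF : Realizes S F c t) {H : (W' → ZMod 2) → (W' → ZMod 2)}
    (h1 : ∀ v w, H v (e w) = F (v ∘ e) w) (h2 : ∀ v, ∀ w ∉ Set.range e, H v w = v w) :
    Realizes (Set.range e) H c t := by
  obtain ⟨Q, k1, k2, k3, k4⟩ := hF
  refine ⟨Q.map (RevGate.map e), ?_, ?_, by rwa [RevCircuit.cnotCount_map],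
    by rwa [RevCircuit.toffoliCount_map]⟩
  · intro g hg
    obtain ⟨g', -, rfl⟩ := List.mem_map.1 hg
    exact g'.map_within e
  · intro v
    funext w
    by_cases hw : w ∈ Set.range e
    · obtain ⟨w, rfl⟩ := hw
      rw [RevCircuit.eval_map_apply, k2, h1]
    · rw [RevCircuit.eval_map_of_notMem e Q v w hw, h2 v w hw]

/-- A family of updates that write outside of `X` and read only `X` can be performed one after
the other. -/
theorem add_sum {ι : Type*} (s : Finset ι) (φ : ι → (W → ZMod 2) → (W → ZMod 2))
    (X : Set W) (cost tcost : ι → ℕ) (h : ∀ i ∈ s, Realizes S (fun v => v + φ i v) (cost i) (tcost i))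
    (hread : ∀ i ∈ s, ∀ v v', Set.EqOn v v' X → φ i v = φ i v')
    (hwrite : ∀ i ∈ s, ∀ v, ∀ w ∈ X, φ i v w = 0) :
    Realizes S (fun v => v + ∑ i ∈ s, φ i v) (∑ i ∈ s, cost i) (∑ i ∈ s, tcost i) := by
  classical
  induction s using Finset.induction_on with
  | empty => exact of_id (by simp)
  | insert a s ha ih =>
    have h1 := ih (fun i hi => h i (by simp [hi])) (fun i hi => hread i (by simp [hi]))
      (fun i hi => hwrite i (by simp [hi]))
    have h2 := h1.comp (h a (by simp))
    rw [Finset.sum_insert ha, Finset.sum_insert ha]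
    refine h2.congr fun v => ?_
    rw [Finset.sum_insert ha, add_assoc]
    congr 2
    refine Finset.sum_congr rfl fun i hi => hread i (by simp [hi]) _ _ fun w hw => ?_
    simp [hwrite a (by simp) v w hw]

/-- Adding the parity of the wires in `A` to every wire in `B`. -/
theorem add_parity (A B : Finset W) (hA : ↑A ⊆ S) (hB : ↑B ⊆ S) (hAB : Disjoint A B) :
    Realizes S (fun v => v + ∑ b ∈ B, Pi.single b (∑ a ∈ A, v a)) (2 * A.card + B.card) 0 := by
  classical
  rcases A.eq_empty_or_nonempty with rfl | ⟨a₀, ha₀⟩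
  · exact (of_id (by simp)).mono le_rfl (Nat.zero_le _) le_rfl
  -- The parity of `A` is gathered in place on one wire `a₀`, copied to `B`, and the gathering is
  -- undone.
  have hA₀ : Realizes S (fun v => v + ∑ a ∈ A.erase a₀, Pi.single a₀ (v a)) A.card 0 := by
    refine (add_sum (A.erase a₀) (fun a v => Pi.single a₀ (v a)) {a₀}ᶜ (fun _ => 1) (fun _ => 0)
      (fun a ha => add_single (hA (Finset.mem_of_mem_erase ha)) (hA ha₀) (Finset.ne_of_mem_erase ha))
      ?_ ?_).mono le_rfl ?_ (by simp)
    · intro a ha v v' hv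
      rw [hv (show a ∈ ({a₀}ᶜ : Set W) from Finset.ne_of_mem_erase ha)]
    · intro a ha v w hw
      simp [show w ≠ a₀ from hw]
    · simpa using Finset.card_erase_le
  have hB₀ : Realizes S (fun v => v + ∑ b ∈ B, Pi.single b (v a₀)) B.card 0 := by
    refine (add_sum B (fun b v => Pi.single b (v a₀)) {a₀} (fun _ => 1) (fun _ => 0)
      (fun b hb => add_single (hA ha₀) (hB hb) ?_) ?_ ?_).mono le_rfl (by simp) (by simp)
    · rintro rfl
      exact Finset.disjoint_left.1 hAB ha₀ hb
    · intro b hb v v' hv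
      rw [hv rfl]
    · rintro b hb v w rfl
      have : w ≠ b := by
        rintro rfl
        exact Finset.disjoint_left.1 hAB ha₀ hb
      simp [this]
  refine ((hA₀.comp (hB₀.comp hA₀)).congr fun v => ?_).mono le_rfl (by omega) le_rfl
  have hsum : ∀ u : W → ZMod 2, (∑ a ∈ A.erase a₀, Pi.single a₀ (u a) : W → ZMod 2)
      = Pi.single a₀ (∑ a ∈ A.erase a₀, u a) := by
    intro u
    funext w
    by_cases hw : w = a₀
    · subst hw; simp
    · simp [hw]
  have hsumB : ∀ x : ZMod 2, ∀ w ∉ B, (∑ b ∈ B, Pi.single b x : W → ZMod 2) w = 0 := by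
    intro x w hw
    rw [Finset.sum_apply]
    refine Finset.sum_eq_zero fun b hb => ?_
    have : w ≠ b := by rintro rfl; exact hw hb
    simp [this]
  have e1 : v a₀ + ∑ a ∈ A.erase a₀, v a = ∑ a ∈ A, v a := Finset.add_sum_erase A v ha₀
  set y : W → ZMod 2 := ∑ b ∈ B, Pi.single b (∑ a ∈ A, v a) with hy
  have hyA : ∀ a ∈ A, y a = 0 := fun a ha => hsumB _ a (Finset.disjoint_left.1 hAB ha)
  simp only [hsum]
  have e2 : (v + (Pi.single a₀ (∑ a ∈ A.erase a₀, v a) : W → ZMod 2)) a₀ = ∑ a ∈ A, v a := by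
    simp [e1]
  rw [e2, ← hy]
  have e3 : ∑ a ∈ A.erase a₀, (v + (Pi.single a₀ (∑ a ∈ A.erase a₀, v a) : W → ZMod 2) + y) a
      = ∑ a ∈ A.erase a₀, v a := by
    refine Finset.sum_congr rfl fun a ha => ?_
    simp [Finset.ne_of_mem_erase ha, hyA a (Finset.mem_of_mem_erase ha)]
  rw [e3]
  funext w
  simp only [Pi.add_apply]
  have := CharTwo.add_self_eq_zero ((Pi.single a₀ (∑ a ∈ A.erase a₀, v a) : W → ZMod 2) w)
  linear_combination (-1 : ZMod 2) * this

end Realizes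

/-! ### In-place linear maps: elimination for band matrices, and permutations of wires. -/

-- This is the factorization M = L M' U at a pivot. U adds the rest of the pivot row's value to wire
-- `i₀`, M' is the Schur complement bordered by the identity, and L adds the pivot wire along the
-- pivot column. Signs disappear in characteristic 2.
open Matrix in
theorem mulVec_eq_of_pivot {ι : Type} [Fintype ι] [DecidableEq ι] (M M' : Matrix ι ι (ZMod 2))
    (i₀ : ι) (h₀ : M i₀ i₀ = 1) (h1 : ∀ i j, M' i j = if i = i₀ ∨ j = i₀ then
      (if i = j then 1 else 0) else M i j + M i i₀ * M i₀ j) (v : ι → ZMod 2) :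
    M *ᵥ v = M' *ᵥ (v + Pi.single i₀ (∑ j with j ≠ i₀, M i₀ j * v j)) +
      fun i => if i = i₀ then 0 else M i i₀ * (v i₀ + ∑ j with j ≠ i₀, M i₀ j * v j) := by
  funext i
  have hs : ∀ g : ι → ZMod 2, ∑ j, g j = g i₀ + ∑ j with j ≠ i₀, g j := by
    intro g
    rw [Finset.filter_ne', Finset.add_sum_erase _ _ (Finset.mem_univ _)]
  rw [mulVec_add, mulVec_single]
  simp only [Pi.add_apply, mulVec, dotProduct]
  rw [hs (fun j => M i j * v j), hs (fun j => M' i j * v j)]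
  by_cases hi : i = i₀
  · subst hi
    have : ∑ j with j ≠ i, M' i j * v j = 0 := by
      refine Finset.sum_eq_zero fun j hj => ?_
      simp [h1, Ne.symm (Finset.mem_filter.1 hj).2]
    rw [this]
    simp [h1, h₀]
  · have : ∑ j with j ≠ i₀, M' i j * v j
        = ∑ j with j ≠ i₀, M i j * v j + M i i₀ * ∑ j with j ≠ i₀, M i₀ j * v j := by
      rw [Finset.mul_sum, ← Finset.sum_add_distrib]
      refine Finset.sum_congr rfl fun j hj => ?_
      rw [h1, if_neg (by simp [hi, (Finset.mem_filter.1 hj).2])]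
      ring
    rw [this, h1 i i₀]
    simp only [hi, Pi.smul_apply, col_apply, h1 i i₀, or_true, if_true, if_false]
    have := CharTwo.add_self_eq_zero (M i i₀ * ∑ j with j ≠ i₀, M i₀ j * v j)
    simp only [smul_zero, zero_mul, add_zero]
    linear_combination -this

theorem ZMod.eq_one_of_ne_zero_two : ∀ x : ZMod 2, x ≠ 0 → x = 1 := by decide

theorem ZMod.sum_filter_ne_zero_eq_sum_mul {ι : Type*} (s : Finset ι) (a v : ι → ZMod 2) :
    ∑ j ∈ s with a j ≠ 0, v j = ∑ j ∈ s, a j * v j := by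
  rw [Finset.sum_filter]
  refine Finset.sum_congr rfl fun j _ => ?_
  split_ifs with h
  · rw [ZMod.eq_one_of_ne_zero_two _ h, one_mul]
  · rw [not_not.1 h, zero_mul]

namespace Realizes

open Matrix

variable {ι : Type} [Fintype ι] [DecidableEq ι]

/-- One elimination step for a matrix with a nonzero diagonal entry. -/
theorem mulVec_of_pivot {M M' : Matrix ι ι (ZMod 2)} {i₀ : ι} (h₀ : M i₀ i₀ = 1)
    (h1 : ∀ i j, M' i j = if i = i₀ ∨ j = i₀ then
      (if i = j then 1 else 0) else M i j + M i i₀ * M i₀ j)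
    (hinj : Function.Injective M.mulVec) {p q c : ℕ}
    (hp : (Finset.univ.filter fun i => i ≠ i₀ ∧ M i i₀ ≠ 0).card ≤ p)
    (hq : (Finset.univ.filter fun j => j ≠ i₀ ∧ M i₀ j ≠ 0).card ≤ q)
    (hM' : Function.Injective M'.mulVec → Realizes Set.univ M'.mulVec c 0) :
    Realizes Set.univ M.mulVec (c + (2 * q + 1) + (2 + p)) 0 := by
  have hE2 := add_parity (S := Set.univ) (Finset.univ.filter fun j => j ≠ i₀ ∧ M i₀ j ≠ 0) {i₀}
    (Set.subset_univ _) (Set.subset_univ _) (by simp)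
  have hE1 := add_parity (S := Set.univ) {i₀} (Finset.univ.filter fun i => i ≠ i₀ ∧ M i i₀ ≠ 0)
    (Set.subset_univ _) (Set.subset_univ _) (by simp)
  have key : ∀ v, M *ᵥ v = (M' *ᵥ (v + ∑ b ∈ {i₀}, Pi.single b
      (∑ a with a ≠ i₀ ∧ M i₀ a ≠ 0, v a))) + ∑ b with b ≠ i₀ ∧ M b i₀ ≠ 0, Pi.single b
        (∑ a ∈ {i₀}, (M' *ᵥ (v + ∑ b ∈ {i₀}, Pi.single b
          (∑ a with a ≠ i₀ ∧ M i₀ a ≠ 0, v a))) a) := by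
    intro v
    have e1 : ∑ a with a ≠ i₀ ∧ M i₀ a ≠ 0, v a = ∑ j with j ≠ i₀, M i₀ j * v j := by
      rw [← ZMod.sum_filter_ne_zero_eq_sum_mul, Finset.filter_filter]
    rw [mulVec_eq_of_pivot M M' i₀ h₀ h1 v]
    simp only [Finset.sum_singleton, e1]
    congr 1
    have e2 : (M' *ᵥ (v + Pi.single i₀ (∑ j with j ≠ i₀, M i₀ j * v j))) i₀
        = v i₀ + ∑ j with j ≠ i₀, M i₀ j * v j := by
      simp [mulVec, dotProduct, h1]
    rw [e2]
    funext i
    rw [Finset.sum_apply]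
    simp only [Pi.single_apply]
    rw [Finset.sum_ite_eq]
    by_cases hi : i = i₀
    · simp [hi]
    · by_cases hM : M i i₀ = 0
      · simp [hM]
      · simp [hi, ZMod.eq_one_of_ne_zero_two _ hM]
  obtain ⟨G, -, -, hG⟩ := hE2.exists_inverse
  have hinj' : Function.Injective M'.mulVec := by
    intro x y hxy
    rw [← hG x, ← hG y] at hxy
    have h := hinj (show M *ᵥ G x = M *ᵥ G y by rw [key, key, hxy])
    rw [← hG x, h, hG y]
  refine ((hE1.comp ((hM' hinj').comp hE2)).congr key).mono le_rfl ?_ le_rfl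
  simp only [Finset.card_singleton]
  omega

/-- Elimination follows the order of `pos`; `k` is the current position, before which the matrix is
already the identity. The lower bandwidth `w` is preserved. The upper one can grow, since a missing
pivot is repaired with a row up to `w` further down; but only rows up to `k + w` are affected and
they reach at most `k + 2 * w`, which the `max` records. So a step meets at most `2 * w` further
entries in the pivot row and `w` in the pivot column: (4w + 1) + (2 + w) gates, and one more to
create a pivot. -/
theorem mulVec_of_band_aux (pos : ι → ℕ) (hpos : Function.Injective pos) (w : ℕ) :
    ∀ (r k : ℕ) (M : Matrix ι ι (ZMod 2)), (∀ i, pos i < k + r) → Function.Injective M.mulVec →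
      (∀ i j, pos i < k ∨ pos j < k → M i j = if i = j then 1 else 0) →
      (∀ i j, M i j ≠ 0 → pos j ≤ max (pos i) (k + w) + w) →
      (∀ i j, M i j ≠ 0 → pos i ≤ pos j + w) →
      Realizes Set.univ M.mulVec ((5 * w + 4) * (Finset.univ.filter fun i => k ≤ pos i).card) 0 := by
  intro r
  induction r with
  | zero =>
    intro k M hk _ h1 _ _
    have : M = 1 := by
      ext i j
      rw [h1 i j (Or.inl (hk i)), Matrix.one_apply]
    subst this
    exact (of_id (by simp)).mono le_rfl (Nat.zero_le _) le_rfl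
  | succ r ih =>
    intro k M hk hinj h1 hup hlow
    -- `pos` need not attain every integer; an unused position costs nothing.
    by_cases hex : ∃ i₀, pos i₀ = k
    swap
    · push Not at hex
      have hlt : ∀ i, pos i < k + 1 → pos i < k := fun i hi => by have := hex i; omega
      refine (ih (k + 1) M (fun i => by have := hk i; omega) hinj
        (fun i j hij => h1 i j (hij.imp (hlt i) (hlt j))) (fun i j hM => ?_) hlow).mono le_rfl ?_ le_rfl
      · have := hup i j hM; omega
      · gcongr with i
        omega
    obtain ⟨i₀, hi₀⟩ := hex
    have hcard : (Finset.univ.filter fun i => k ≤ pos i).card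
        = (Finset.univ.filter fun i => k + 1 ≤ pos i).card + 1 := by
      have : (Finset.univ.filter fun i => k ≤ pos i)
          = insert i₀ (Finset.univ.filter fun i => k + 1 ≤ pos i) := by
        ext i
        simp only [Finset.mem_filter, Finset.mem_univ, true_and, Finset.mem_insert]
        constructor
        · intro h
          by_cases hi : pos i = k
          · exact Or.inl (hpos (hi.trans hi₀.symm))
          · right; omega
        · rintro (rfl | h) <;> omega
      rw [this, Finset.card_insert_of_notMem (by simp; omega)]
    have main : ∀ N : Matrix ι ι (ZMod 2), N i₀ i₀ = 1 → Function.Injective N.mulVec →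
      (∀ i j, pos i < k ∨ pos j < k → N i j = if i = j then 1 else 0) →
      (∀ i j, N i j ≠ 0 → pos j ≤ max (pos i) (k + w) + w) →
      (∀ i j, N i j ≠ 0 → pos i ≤ pos j + w) → Realizes Set.univ N.mulVec
        ((5 * w + 4) * (Finset.univ.filter fun i => k + 1 ≤ pos i).card + (2 * (2 * w) + 1) + (2 + w)) 0 := by
      intro N h₀ hinj h1 hup hlow
      have hzero : ∀ i j, pos i < k ∨ pos j < k → i ≠ j → N i j = 0 := by
        intro i j h hij
        rw [h1 i j h, if_neg hij]
      have hcardle : ∀ (P : ι → Prop) [DecidablePred P] (n : ℕ),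
          (∀ i, P i → k < pos i ∧ pos i ≤ k + n) → (Finset.univ.filter P).card ≤ n := by
        intro P _ n hP
        calc (Finset.univ.filter P).card = ((Finset.univ.filter P).image pos).card :=
              (Finset.card_image_of_injective _ hpos).symm
          _ ≤ (Finset.Ioc k (k + n)).card := by
              refine Finset.card_le_card fun x hx => ?_
              simp only [Finset.mem_image, Finset.mem_filter, Finset.mem_univ, true_and] at hx
              obtain ⟨i, hi, rfl⟩ := hx
              exact Finset.mem_Ioc.2 (hP i hi)
          _ = n := by simp
      have hne : ∀ i, i ≠ i₀ → pos i ≠ k := fun i hi h => hi (hpos (h.trans hi₀.symm))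
      refine mulVec_of_pivot (M' := Matrix.of fun i j => if i = i₀ ∨ j = i₀ then
        (if i = j then 1 else 0) else N i j + N i i₀ * N i₀ j) h₀ (fun i j => rfl) hinj
        (hcardle _ _ ?_) (hcardle _ _ ?_) ?_
      · rintro i ⟨hi, hN⟩
        have a1 := hne i hi
        have a2 := hlow i i₀ hN
        have a3 : ¬ pos i < k := fun h => hN (hzero i i₀ (Or.inl h) hi)
        omega
      · rintro j ⟨hj, hN⟩
        have a1 := hne j hj
        have a2 := hup i₀ j hN
        have a3 : ¬ pos j < k := fun h => hN (hzero i₀ j (Or.inr h) hj.symm)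
        omega
      · intro hinj'
        have hcases : ∀ i j, (Matrix.of fun i j => if i = i₀ ∨ j = i₀ then
            (if i = j then 1 else 0) else N i j + N i i₀ * N i₀ j) i j ≠ 0 →
            i = j ∨ N i j ≠ 0 ∨ (i ≠ i₀ ∧ j ≠ i₀ ∧ N i i₀ ≠ 0 ∧ N i₀ j ≠ 0) := by
          intro i j h
          simp only [Matrix.of_apply] at h
          by_contra hcon
          push Not at hcon
          obtain ⟨c1, c2, c3⟩ := hcon
          apply h
          split_ifs with h3
          · rfl
          · push Not at h3
            by_cases h4 : N i i₀ = 0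
            · simp [c2, h4]
            · simp [c2, c3 h3.1 h3.2 h4]
        refine ih (k + 1) _ (fun i => by have := hk i; omega) hinj' ?_ ?_ ?_
        · intro i j hij
          simp only [Matrix.of_apply]
          by_cases h3 : i = i₀ ∨ j = i₀
          · rw [if_pos h3]
          · rw [if_neg h3]
            push Not at h3
            have b1 := hne i h3.1
            have b2 := hne j h3.2
            have b3 : pos i < k ∨ pos j < k := by omega
            rw [h1 i j b3]
            rcases b3 with b3 | b3
            · rw [hzero i i₀ (Or.inl b3) h3.1]; simp
            · rw [hzero i₀ j (Or.inr b3) h3.2.symm]; simp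
        · intro i j h
          rcases hcases i j h with rfl | h | ⟨_, _, h4, h5⟩
          · omega
          · have := hup i j h; omega
          · have := hup i₀ j h5; omega
        · intro i j h
          rcases hcases i j h with rfl | h | ⟨c1, c2, h4, h5⟩
          · omega
          · exact hlow i j h
          · have a1 := hlow i i₀ h4
            have a2 : ¬ pos j < k := fun h => h5 (hzero i₀ j (Or.inr h) c2.symm)
            omega
    by_cases h₀ : M i₀ i₀ = 0
    swap
    · refine (main M (ZMod.eq_one_of_ne_zero_two _ h₀) hinj h1 hup hlow).mono le_rfl ?_ le_rfl
      rw [hcard]; linarith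
    -- With a zero on the diagonal, injectivity yields a nonzero entry of the column at a later
    -- position. Adding row `p` to row `i₀` creates the pivot, and a single CNOT on the output
    -- undoes this.
    obtain ⟨p, hp⟩ : ∃ p, M p i₀ ≠ 0 := by
      by_contra hcon
      push Not at hcon
      have : (Pi.single i₀ 1 : ι → ZMod 2) = 0 := by
        apply hinj
        funext i
        simp [hcon]
      simpa using congrFun this i₀
    have hpi : p ≠ i₀ := by rintro rfl; exact hp h₀
    have hpk : k ≤ pos p := by
      by_contra hcon
      apply hp
      rw [h1 p i₀ (Or.inl (by omega)), if_neg hpi]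
    have hpk' := hlow p i₀ hp
    have hT := add_single (S := Set.univ) (Set.mem_univ p) (Set.mem_univ i₀) hpi
    set N : Matrix ι ι (ZMod 2) := Matrix.of fun i j => M i j + if i = i₀ then M p j else 0 with hN
    have hNM : ∀ v, M *ᵥ v = N *ᵥ v + Pi.single i₀ ((N *ᵥ v) p) := by
      intro v
      have e1 : ∀ i, (N *ᵥ v) i = (M *ᵥ v) i + if i = i₀ then (M *ᵥ v) p else 0 := by
        intro i
        simp only [mulVec, dotProduct, hN, Matrix.of_apply, add_mul, Finset.sum_add_distrib]
        split_ifs <;> simp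
      funext i
      by_cases hi : i = i₀
      · subst hi
        simp only [Pi.add_apply, e1, if_true, Pi.single_eq_same, if_neg hpi]
        linear_combination -CharTwo.add_self_eq_zero ((M *ᵥ v) p)
      · simp [e1, hi]
    have hNor : ∀ i j, N i j ≠ 0 → M i j ≠ 0 ∨ (i = i₀ ∧ M p j ≠ 0) := by
      intro i j h
      by_contra hcon
      push Not at hcon
      apply h
      simp only [hN, Matrix.of_apply, hcon.1, zero_add]
      split_ifs with h3
      · exact hcon.2 h3
      · rfl
    have hmain := main N ?_ ?_ ?_ ?_ ?_
    · refine ((hT.comp hmain).congr hNM).mono le_rfl ?_ le_rfl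
      rw [hcard]; linarith
    · simp [hN, h₀, ZMod.eq_one_of_ne_zero_two _ hp]
    · intro x y hxy
      apply hinj
      change N *ᵥ x = N *ᵥ y at hxy
      rw [hNM, hNM, hxy]
    · intro i j hij
      rw [← h1 i j hij]
      simp only [hN, Matrix.of_apply]
      split_ifs with h3
      · subst h3
        have hj : pos j < k := by omega
        have hpj : p ≠ j := by rintro rfl; omega
        rw [h1 p j (Or.inr hj), if_neg hpj, add_zero]
      · rw [add_zero]
    · intro i j hij
      rcases hNor i j hij with h | ⟨hi, h⟩
      · exact hup i j h
      · subst hi; have := hup p j h; omega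
    · intro i j hij
      rcases hNor i j hij with h | ⟨hi, h⟩
      · exact hlow i j h
      · subst hi
        have a2 : ¬ pos j < k := by
          intro hj
          apply h
          rw [h1 p j (Or.inr hj), if_neg (by rintro rfl; omega)]
        omega

/-- An invertible band matrix of bandwidth `w` is applied in place by `O(w)` CNOT gates for each
row. -/
theorem mulVec_of_band (pos : ι → ℕ) (hpos : Function.Injective pos) (w : ℕ)
    (M : Matrix ι ι (ZMod 2)) (hinj : Function.Injective M.mulVec)
    (hup : ∀ i j, M i j ≠ 0 → pos j ≤ pos i + w) (hlow : ∀ i j, M i j ≠ 0 → pos i ≤ pos j + w) :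
    Realizes Set.univ M.mulVec ((5 * w + 4) * Fintype.card ι) 0 := by
  refine (mulVec_of_band_aux pos hpos w (Finset.univ.sup pos + 1) 0 M ?_ hinj ?_ ?_ hlow).mono
    le_rfl ?_ le_rfl
  · intro i
    have := Finset.le_sup (f := pos) (Finset.mem_univ i)
    omega
  · intro i j h; omega
  · intro i j h
    have := hup i j h; omega
  · gcongr
    exact Finset.card_le_univ _

/-- A permutation of the wires is performed by three CNOT gates for each wire. -/
theorem comp_perm (σ : Equiv.Perm ι) :
    Realizes Set.univ (fun v : ι → ZMod 2 => v ∘ σ) (3 * σ.support.card) 0 := by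
  induction h : σ.support.card using Nat.strong_induction_on generalizing σ with
  | _ n ih =>
  by_cases hσ : σ = 1
  · subst hσ
    exact (of_id (by simp)).mono le_rfl (Nat.zero_le _) le_rfl
  obtain ⟨x, hx⟩ : ∃ x, σ x ≠ x := by
    by_contra hcon
    push Not at hcon
    exact hσ (Equiv.ext hcon)
  -- Composition with the swap makes `x` a fixed point, so the support shrinks; the swap itself is
  -- three alternating CNOT gates.
  have hlt := Equiv.Perm.card_support_swap_mul hx
  have h1 := ih _ (h ▸ hlt) (Equiv.swap x (σ x) * σ) rfl
  have hT1 := add_single (S := Set.univ) (Set.mem_univ x) (Set.mem_univ (σ x)) (Ne.symm hx)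
  have hT2 := add_single (S := Set.univ) (Set.mem_univ (σ x)) (Set.mem_univ x) hx
  refine ((h1.comp (hT1.comp (hT2.comp hT1))).congr fun v => ?_).mono le_rfl (by omega) le_rfl
  have hsw : ∀ u : ι → ZMod 2, u ∘ (Equiv.swap x (σ x)) = (fun u => u + Pi.single (σ x) (u x))
      ((fun u => u + Pi.single x (u (σ x))) ((fun u => u + Pi.single (σ x) (u x)) u)) := by
    intro u
    funext i
    have h2 := fun z : ZMod 2 => CharTwo.add_self_eq_zero z
    by_cases hi : i = x
    · subst hi
      simp [Ne.symm hx]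
      linear_combination -h2 (u i)
    · by_cases hi' : i = σ x
      · subst hi'
        simp [Ne.symm hx]
        linear_combination -h2 (u x) - h2 (u (σ x))
      · simp [hi, hi', Equiv.swap_apply_of_ne_of_ne hi hi']
  change _ = (fun u => u + Pi.single (σ x) (u x))
      ((fun u => u + Pi.single x (u (σ x))) ((fun u => u + Pi.single (σ x) (u x)) v))
        ∘ (Equiv.swap x (σ x) * σ)
  rw [← hsw]
  funext i
  simp

end Realizes

/-! ### Folding a cycle onto a line. -/

/-- The position of `r` when the cycle `0, …, h - 1` is laid flat on a line. -/
def foldCycle (h r : ℕ) : ℕ := if 2 * r < h then 2 * r else 2 * (h - 1 - r) + 1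

theorem foldCycle_le {h r : ℕ} (hr : r < h) : foldCycle h r ≤ h := by
  unfold foldCycle
  split_ifs <;> omega

theorem foldCycle_injOn {h r s : ℕ} (hr : r < h) (hs : s < h)
    (hrs : foldCycle h r = foldCycle h s) : r = s := by
  unfold foldCycle at hrs
  split_ifs at hrs <;> omega

/-- The cycle goes out along the even positions and comes back along the odd ones, so neighbours on
it, including h - 1 and 0, are at most 2 apart on the line. -/
theorem foldCycle_add_mod {h : ℕ} (hh : 0 < h) (r t : ℕ) :
    foldCycle h ((r + t) % h) ≤ foldCycle h (r % h) + 2 * t ∧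
      foldCycle h (r % h) ≤ foldCycle h ((r + t) % h) + 2 * t := by
  induction t with
  | zero => simp
  | succ t ih =>
    have key : ∀ s < h, foldCycle h ((s + 1) % h) ≤ foldCycle h s + 2 ∧
        foldCycle h s ≤ foldCycle h ((s + 1) % h) + 2 := by
      intro s hs
      rcases (show s + 1 < h ∨ s + 1 = h by omega) with h1 | h1
      · rw [Nat.mod_eq_of_lt h1]
        unfold foldCycle
        constructor <;> split_ifs <;> omega
      · rw [h1, Nat.mod_self]
        unfold foldCycle
        constructor <;> split_ifs <;> omega
    have h2 := key ((r + t) % h) (Nat.mod_lt _ hh)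
    rw [Nat.mod_add_mod] at h2
    rw [← add_assoc]
    omega

/-! ### The power basis of 𝔽₂[x]/(f) and the reduction of powers of x. -/

noncomputable section

theorem Polynomial.eq_sum_range_of_coeff_eq_zero {p : (ZMod 2)[X]} {n : ℕ}
    (hp : ∀ i, n ≤ i → p.coeff i = 0) : p = ∑ i ∈ Finset.range n, C (p.coeff i) * X ^ i := by
  ext i
  simp only [finsetSum_coeff, coeff_C_mul, coeff_X_pow, mul_ite, mul_one, mul_zero]
  rw [Finset.sum_ite_eq]
  split_ifs with h
  · rfl
  · exact hp i (by simpa using h)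

namespace AdjoinRoot

variable {f : (ZMod 2)[X]} (hf : f.Monic)

theorem mk_modByMonicHom (y : AdjoinRoot f) : mk f (modByMonicHom hf y) = y :=
  mk_leftInverse hf y

theorem degree_modByMonicHom_lt (y : AdjoinRoot f) : (modByMonicHom hf y).degree < f.degree := by
  obtain ⟨p, rfl⟩ := mk_surjective y
  rw [modByMonicHom_mk]
  exact degree_modByMonic_lt p hf

theorem coeff_modByMonicHom_eq_zero (y : AdjoinRoot f) {i : ℕ} (hi : f.natDegree ≤ i) :
    (modByMonicHom hf y).coeff i = 0 := by
  apply coeff_eq_zero_of_degree_lt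
  refine (degree_modByMonicHom_lt hf y).trans_le ?_
  rw [degree_eq_natDegree hf.ne_zero]
  exact_mod_cast hi

theorem modByMonicHom_mk_of_degree_lt {p : (ZMod 2)[X]} (hp : p.degree < f.degree) :
    modByMonicHom hf (mk f p) = p := by
  rw [modByMonicHom_mk, (modByMonic_eq_self_iff hf).2 hp]

theorem sum_coeff_modByMonicHom (y : AdjoinRoot f) :
    ∑ i ∈ Finset.range f.natDegree, of f ((modByMonicHom hf y).coeff i) * root f ^ i = y := by
  conv_rhs => rw [← mk_modByMonicHom hf y, eq_sum_range_of_coeff_eq_zero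
    (fun i hi => coeff_modByMonicHom_eq_zero hf y hi)]
  rw [map_sum]
  refine Finset.sum_congr rfl fun i _ => ?_
  rw [map_mul, map_pow, mk_X, mk_C]

theorem map_of_mul (φ : AdjoinRoot f →+ AdjoinRoot f) (c : ZMod 2) (y : AdjoinRoot f) :
    φ (of f c * y) = of f c * φ y := by
  rcases (show ∀ c : ZMod 2, c = 0 ∨ c = 1 by decide) c with rfl | rfl <;> simp

theorem mk_add_self (y : AdjoinRoot f) : y + y = 0 := by
  obtain ⟨p, rfl⟩ := mk_surjective y
  rw [← map_add, CharTwo.add_self_eq_zero, map_zero]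

/-- The matrix of an additive map in the basis of the powers of the root. -/
def powMatrix (φ : AdjoinRoot f →+ AdjoinRoot f) (m : ℕ) : Matrix (Fin m) (Fin m) (ZMod 2) :=
  Matrix.of fun i j => (modByMonicHom hf (φ (root f ^ (j : ℕ)))).coeff i

theorem fieldElem_eq_mk {m : ℕ} (v : Fin m → ZMod 2) :
    fieldElem f v = mk f (∑ i : Fin m, C (v i) * X ^ (i : ℕ)) := by
  simp [fieldElem]

theorem fieldElem_powMatrix_mulVec (φ : AdjoinRoot f →+ AdjoinRoot f) {m : ℕ}
    (hm : f.natDegree = m) (v : Fin m → ZMod 2) :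
    fieldElem f ((powMatrix hf φ m).mulVec v) = φ (fieldElem f v) := by
  subst hm
  simp only [fieldElem, map_sum, map_of_mul, Matrix.mulVec, dotProduct, powMatrix, Matrix.of_apply,
    Finset.sum_mul, map_mul]
  rw [Finset.sum_comm]
  refine Finset.sum_congr rfl fun j _ => ?_
  conv_rhs => rw [← sum_coeff_modByMonicHom hf (φ (root f ^ (j : ℕ))), Finset.sum_range,
    Finset.mul_sum]
  refine Finset.sum_congr rfl fun i _ => ?_
  ring

include hf in
theorem fieldElem_injective {m : ℕ} (hm : f.natDegree = m) :
    Function.Injective (fieldElem f : (Fin m → ZMod 2) → AdjoinRoot f) := by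
  intro v w hvw
  rw [fieldElem_eq_mk, fieldElem_eq_mk] at hvw
  have hdeg : ∀ v : Fin m → ZMod 2, (∑ i : Fin m, C (v i) * X ^ (i : ℕ)).degree < f.degree := by
    intro v
    rw [degree_eq_natDegree hf.ne_zero, hm]
    refine (degree_sum_le _ _).trans_lt ((Finset.sup_lt_iff (WithBot.bot_lt_coe m)).2 fun i _ => ?_)
    exact (degree_C_mul_X_pow_le _ _).trans_lt (WithBot.coe_lt_coe.2 i.2)
  have h2 := congrArg (modByMonicHom hf) hvw
  rw [modByMonicHom_mk_of_degree_lt hf (hdeg v), modByMonicHom_mk_of_degree_lt hf (hdeg w)] at h2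
  funext i
  have h3 := congrArg (fun p => coeff p (i : ℕ)) h2
  simpa [finsetSum_coeff, coeff_X_pow, Fin.val_inj] using h3

theorem powMatrix_mulVec_injective (φ : AdjoinRoot f →+ AdjoinRoot f) (hφ : Function.Injective φ)
    {m : ℕ} (hm : f.natDegree = m) : Function.Injective (powMatrix hf φ m).mulVec := by
  intro v w hvw
  apply fieldElem_injective hf hm
  apply hφ
  rw [← fieldElem_powMatrix_mulVec hf φ hm, ← fieldElem_powMatrix_mulVec hf φ hm, hvw]

theorem coeff_modByMonicHom_root_pow_of_lt {k i : ℕ} (hk : k < f.natDegree)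
    (h : (modByMonicHom hf (root f ^ k)).coeff i ≠ 0) : i = k := by
  rw [← mk_X, ← map_pow, modByMonicHom_mk_of_degree_lt hf (by
    rw [degree_X_pow, degree_eq_natDegree hf.ne_zero]; exact_mod_cast hk), coeff_X_pow] at h
  by_contra hik
  exact h (if_neg hik)

end AdjoinRoot

/-- The polynomial `f = x ^ m + g` with `deg g < m`. -/
structure IsSparseModulus (f g : (ZMod 2)[X]) (m : ℕ) : Prop where
  eq : f = X ^ m + g
  lt : g.natDegree < m

namespace IsSparseModulus

open AdjoinRoot

variable {f g : (ZMod 2)[X]} {m : ℕ} (h : IsSparseModulus f g m)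
include h

theorem degree_lt : g.degree < m :=
  degree_le_natDegree.trans_lt (by exact_mod_cast h.lt)

theorem monic : f.Monic := by
  rw [h.eq]
  exact monic_X_pow_add h.degree_lt

theorem natDegree_eq : f.natDegree = m := by
  rw [h.eq]
  rw [natDegree_add_eq_left_of_natDegree_lt (by simpa using h.lt), natDegree_X_pow]

theorem degree_eq : f.degree = m := by
  rw [degree_eq_natDegree h.monic.ne_zero, h.natDegree_eq]

theorem root_pow : root f ^ m = AdjoinRoot.mk f g := by
  have h1 : AdjoinRoot.mk f (X ^ m + g) = 0 := by rw [← h.eq, mk_self]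
  rw [map_add, map_pow, mk_X] at h1
  rw [eq_neg_of_add_eq_zero_left h1]
  exact neg_eq_of_add_eq_zero_left (mk_add_self _)

theorem root_pow_of_le {k : ℕ} (hk : m ≤ k) : root f ^ k = AdjoinRoot.mk f (X ^ (k - m) * g) := by
  rw [map_mul, map_pow, mk_X, ← h.root_pow, ← pow_add, Nat.sub_add_cancel hk]

/-- In this range of `k` one substitution x^m = g suffices, because x^(k - m) g already has degree
below m. -/
theorem coeff_root_pow_aux {k i : ℕ} (hk : k + g.natDegree < 2 * m)
    (hi : (modByMonicHom h.monic (root f ^ k)).coeff i ≠ 0) :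
    ∃ t ≤ g.natDegree, ∃ e ≤ 1, i + e * m = k + t := by
  rcases lt_or_ge k m with hkm | hkm
  · have := coeff_modByMonicHom_root_pow_of_lt h.monic (by rwa [h.natDegree_eq]) hi
    exact ⟨0, Nat.zero_le _, 0, by simp, by simp [this]⟩
  · rw [h.root_pow_of_le hkm, modByMonicHom_mk_of_degree_lt] at hi
    · rw [coeff_X_pow_mul'] at hi
      split_ifs at hi with h1
      · exact ⟨i - (k - m), le_natDegree_of_ne_zero hi, 1, le_rfl, by omega⟩
      · exact absurd rfl hi
    · rw [h.degree_eq]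
      refine degree_le_natDegree.trans_lt ?_
      have : (X ^ (k - m) * g).natDegree ≤ (k - m) + g.natDegree :=
        natDegree_mul_le.trans (by simp)
      exact_mod_cast (show (X ^ (k - m) * g).natDegree < m by omega)

/-- The support of the reduction of `x ^ k` modulo `f`, as offsets modulo `m`. -/
theorem coeff_root_pow {k i : ℕ} (hd : 2 * g.natDegree ≤ m) (hk : k < 2 * m)
    (hi : (modByMonicHom h.monic (root f ^ k)).coeff i ≠ 0) :
    ∃ t ≤ 2 * g.natDegree, ∃ e ≤ 2, i + e * m = k + t := by
  rcases lt_or_ge (k + g.natDegree) (2 * m) with hkm | hkm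
  · obtain ⟨t, ht, e, he, hte⟩ := h.coeff_root_pow_aux hkm hi
    exact ⟨t, by omega, e, by omega, hte⟩
  -- One substitution may overflow here, so each term x^(k - m + j) of x^(k - m) g is reduced once
  -- more. The assumption 2d ≤ m guarantees that this is the last time, and the two offsets add up
  -- to at most 2d.
  · have hlt := h.lt
    have h1 : root f ^ k = ∑ j ∈ Finset.range (g.natDegree + 1),
        g.coeff j • root f ^ (k - m + j) := by
      rw [h.root_pow_of_le (by omega)]
      conv_lhs => rw [as_sum_range_C_mul_X_pow g]
      rw [Finset.mul_sum, map_sum]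
      refine Finset.sum_congr rfl fun j _ => ?_
      rw [mul_left_comm, ← pow_add, map_mul, map_pow, mk_X, mk_C, Algebra.smul_def]
      rfl
    rw [h1, map_sum, finsetSum_coeff] at hi
    obtain ⟨j, hj, hj'⟩ := Finset.exists_ne_zero_of_sum_ne_zero hi
    rw [map_smul, coeff_smul, smul_eq_mul] at hj'
    have hj2 := Finset.mem_range.1 hj
    obtain ⟨t, ht, e, he, hte⟩ := h.coeff_root_pow_aux (by omega) (right_ne_zero_of_mul hj')
    refine ⟨j + t, by omega, e + 1, by omega, ?_⟩
    rw [add_mul]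
    omega

end IsSparseModulus
end

/-! ### In-place multiplication by 1 + x^s and in-place squaring. -/

noncomputable section

theorem Realizes.exists_cnotImplements {f : (ZMod 2)[X]} {m c : ℕ}
    {F : (Fin m → ZMod 2) → (Fin m → ZMod 2)} (hF : Realizes Set.univ F c 0)
    {φ : AdjoinRoot f → AdjoinRoot f} (hφ : ∀ v, fieldElem f (F v) = φ (fieldElem f v)) :
    ∃ Q : RevCircuit (Fin m), CnotImplements f m φ Q ∧ Q.cnotCount ≤ c := by
  obtain ⟨Q, -, h2, h3, h4⟩ := hF
  exact ⟨Q, ⟨Nat.le_zero.1 h4, fun v => by rw [h2, hφ]⟩, h3⟩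

instance AdjoinRoot.charTwo (f : (ZMod 2)[X]) [Fact (Irreducible f)] : CharP (AdjoinRoot f) 2 :=
  charP_of_injective_algebraMap (algebraMap (ZMod 2) (AdjoinRoot f)).injective 2

/-- The wire on which the coefficient of `x ^ (2 * j)` is collected by the squaring. -/
theorem exists_doubling_perm (m : ℕ) : ∃ σ : Equiv.Perm (Fin m), ∀ j : Fin m,
    ∃ e ≤ 1, ∃ b ≤ 1, (σ j : ℕ) + e * m = 2 * j + b := by
  -- The indices with 2j ≥ m have to fill the odd positions. The number 2j - m is odd for odd m and
  -- needs a shift by 1 for even m.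
  have hlt : ∀ j : Fin m, (if 2 * (j : ℕ) < m then 2 * (j : ℕ) else 2 * j - m + (1 - m % 2)) < m := by
    intro j
    have := j.2
    split_ifs <;> omega
  have hinj : Function.Injective fun j : Fin m => (⟨_, hlt j⟩ : Fin m) := by
    intro i j hij
    have h1 := i.2
    have h2 := j.2
    simp only [Fin.mk.injEq] at hij
    ext
    split_ifs at hij <;> omega
  refine ⟨Equiv.ofBijective _ (Finite.injective_iff_bijective.1 hinj), fun j => ?_⟩
  simp only [Equiv.ofBijective_apply]
  have := j.2
  split_ifs with h1
  · exact ⟨0, by simp, 0, by simp, by simp⟩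
  · exact ⟨1, by simp, 1 - m % 2, by omega, by omega⟩

namespace IsSparseModulus

open AdjoinRoot

variable {f g : (ZMod 2)[X]} {m : ℕ} (h : IsSparseModulus f g m)

/-- Multiplication by `1 + x ^ s` in `𝔽₂[x]/(f)`. -/
def mulOneAdd (f : (ZMod 2)[X]) (s : ℕ) : AdjoinRoot f →+ AdjoinRoot f :=
  AddMonoidHom.mulLeft (1 + root f ^ s)

include h

theorem one_add_root_pow_ne_zero {s : ℕ} (hs0 : 0 < s) (hs : s < m) :
    (1 + root f ^ s : AdjoinRoot f) ≠ 0 := by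
  have h1 : (1 + root f ^ s : AdjoinRoot f) = AdjoinRoot.mk f (X ^ s + C 1) := by
    rw [map_add, map_pow, mk_X, map_one, map_one, add_comm]
  rw [h1]
  refine mk_ne_zero_of_natDegree_lt h.monic (monic_X_pow_add_C 1 hs0.ne').ne_zero ?_
  rw [natDegree_X_pow_add_C, h.natDegree_eq]
  exact hs

/-- As m is 2s or 2s - 1, both terms of x^j + x^(j + s) keep the residue of the exponent modulo s up
to a shift by at most 2d + 2. Folding the cycle of residues doubles this to 4d + 4. Interleaving the
at most two indices of equal residue doubles it again and adds 1, whence the width 8d + 9. -/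
theorem realizes_mulOneAdd [Fact (Irreducible f)] {s : ℕ} (hs0 : 0 < s) (hsm : s < m)
    (hs : m = 2 * s ∨ m + 1 = 2 * s) :
    Realizes Set.univ (powMatrix h.monic (mulOneAdd f s) m).mulVec
      ((5 * (8 * g.natDegree + 9) + 4) * m) 0 := by
  have hinj : Function.Injective (mulOneAdd f s) :=
    mul_right_injective₀ (h.one_add_root_pow_ne_zero hs0 hsm)
  have hfold : ∀ i : Fin m, foldCycle s (i % s) ≤ s := fun i => foldCycle_le (Nat.mod_lt _ hs0)
  have hdiv : ∀ i : Fin m, (i : ℕ) / s < 2 := fun i =>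
    Nat.div_lt_of_lt_mul (by have := i.2; omega)
  have key : ∀ i j : Fin m, powMatrix h.monic (mulOneAdd f s) m i j ≠ 0 →
      foldCycle s (j % s) ≤ foldCycle s (i % s) + 2 * (2 * g.natDegree + 2) ∧
      foldCycle s (i % s) ≤ foldCycle s (j % s) + 2 * (2 * g.natDegree + 2) := by
    intro i j hij
    -- If 2d > m, all folded positions lie within the claimed distance anyway.
    rcases lt_or_ge m (2 * g.natDegree) with hd | hd
    · have h1 := hfold i
      have h2 := hfold j
      constructor <;> omega
    have hij' : (modByMonicHom h.monic (root f ^ (j : ℕ))).coeff i ≠ 0 ∨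
        (modByMonicHom h.monic (root f ^ ((j : ℕ) + s))).coeff i ≠ 0 := by
      by_contra hcon
      push Not at hcon
      apply hij
      have : mulOneAdd f s (root f ^ (j : ℕ)) = root f ^ (j : ℕ) + root f ^ ((j : ℕ) + s) := by
        simp only [mulOneAdd, AddMonoidHom.coe_mulLeft]
        ring
      simp only [powMatrix, Matrix.of_apply, this, map_add, coeff_add, hcon, add_zero]
    rcases hij' with hij' | hij'
    · have := coeff_modByMonicHom_root_pow_of_lt h.monic (by rw [h.natDegree_eq]; exact j.2) hij'
      rw [this]
      constructor <;> omega
    · obtain ⟨t, ht, e, he, hte⟩ := h.coeff_root_pow hd (by have := j.2; omega) hij'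
      obtain ⟨u, hu, hmod⟩ : ∃ u ≤ 2 * g.natDegree + 2, (i : ℕ) % s = (j + u) % s := by
        rcases hs with hs | hs
        · refine ⟨t, by omega, ?_⟩
          have h1 : (i : ℕ) + s * (2 * e) = j + t + s * 1 := by
            have : e * m = e * (2 * s) := by rw [← hs]
            linarith
          have h2 := congrArg (· % s) h1
          simpa only [Nat.add_mul_mod_self_left] using h2
        -- Here m ≡ -1 modulo s, so each subtraction of m moves the residue by one.
        · refine ⟨t + e, by omega, ?_⟩
          have h1 : (i : ℕ) + s * (2 * e) = j + (t + e) + s * 1 := by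
            have : e * m + e = e * (2 * s) := by rw [← hs]; ring
            linarith
          have h2 := congrArg (· % s) h1
          simpa only [Nat.add_mul_mod_self_left] using h2
      have := foldCycle_add_mod hs0 j u
      rw [hmod]
      constructor <;> omega
  refine (Realizes.mulVec_of_band (fun i : Fin m => 2 * foldCycle s (i % s) + i / s) ?_
    (8 * g.natDegree + 9) _ (powMatrix_mulVec_injective h.monic _ hinj h.natDegree_eq)
    ?_ ?_).mono le_rfl (by simp) le_rfl
  · intro i j hij
    simp only at hij
    have h1 := hdiv i
    have h2 := hdiv j
    obtain ⟨h3, h4⟩ : (i : ℕ) / s = j / s ∧ foldCycle s (i % s) = foldCycle s (j % s) := by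
      generalize (i : ℕ) / s = x at *
      generalize (j : ℕ) / s = y at *
      omega
    have h4 := foldCycle_injOn (Nat.mod_lt _ hs0) (Nat.mod_lt _ hs0) h4
    ext
    rw [← Nat.mod_add_div i s, ← Nat.mod_add_div j s, h3, h4]
  · intro i j hij
    have h1 := hdiv i
    have h2 := hdiv j
    have h3 := key i j hij
    generalize (i : ℕ) / s = x at *
    generalize (j : ℕ) / s = y at *
    omega
  · intro i j hij
    have h1 := hdiv i
    have h2 := hdiv j
    have h3 := key i j hij
    generalize (i : ℕ) / s = x at *
    generalize (j : ℕ) / s = y at *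
    omega

/-- Since x^j goes to x^(2j), moving wire j to a place within one of 2j modulo m leaves a matrix `B`
that is banded around the cyclic diagonal, with offsets at most 2d on one side and 1 on the other.
Folding doubles them, which gives the width 4d + 2. The permutation accounts for 3m further gates.
-/
theorem realizes_frobenius [Fact (Irreducible f)] :
    Realizes Set.univ (powMatrix h.monic (frobenius (AdjoinRoot f) 2 : AdjoinRoot f →+ AdjoinRoot f)
      m).mulVec ((5 * (4 * g.natDegree + 2) + 7) * m) 0 := by
  have hm0 : 0 < m := (Nat.zero_le _).trans_lt h.lt
  set φ : AdjoinRoot f →+ AdjoinRoot f := (frobenius (AdjoinRoot f) 2 : AdjoinRoot f →+ AdjoinRoot f)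
    with hφ
  have hφa : ∀ y, φ y = y ^ 2 := fun y => rfl
  obtain ⟨σ, hσ⟩ := exists_doubling_perm m
  set M := powMatrix h.monic φ m with hM
  have hinj : Function.Injective M.mulVec :=
    powMatrix_mulVec_injective h.monic _ (frobenius_inj (AdjoinRoot f) 2) h.natDegree_eq
  set B : Matrix (Fin m) (Fin m) (ZMod 2) := Matrix.of fun i j => M i (σ.symm j) with hB
  have hBM : ∀ v, M.mulVec v = B.mulVec (v ∘ σ.symm) := by
    intro v
    funext i
    simp only [Matrix.mulVec, dotProduct, hB, Matrix.of_apply, Function.comp]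
    exact (Equiv.sum_comp σ.symm fun j => M i j * v j).symm
  have hBinj : Function.Injective B.mulVec := by
    intro x y hxy
    have e : ∀ z : Fin m → ZMod 2, z = (z ∘ σ) ∘ σ.symm := by
      intro z; funext i; simp
    rw [e x, e y, ← hBM, ← hBM] at hxy
    have h1 := hinj hxy
    rw [e x, e y, h1]
  have key : ∀ i j : Fin m, B i j ≠ 0 →
      foldCycle m j ≤ foldCycle m i + (4 * g.natDegree + 2) ∧
      foldCycle m i ≤ foldCycle m j + (4 * g.natDegree + 2) := by
    intro i c hic
    rcases lt_or_ge m (2 * g.natDegree) with hd | hd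
    · have h1 := foldCycle_le i.2
      have h2 := foldCycle_le c.2
      constructor <;> omega
    obtain ⟨j, rfl⟩ := σ.surjective c
    simp only [hB, hM, Matrix.of_apply, powMatrix, Equiv.symm_apply_apply, hφa, ← pow_mul] at hic
    obtain ⟨t, ht, e, he, hte⟩ := h.coeff_root_pow hd (by have := j.2; omega) hic
    obtain ⟨e', he', b, hb, heb⟩ := hσ j
    have hj2 : (σ j : ℕ) + e' * m + t = i + e * m + b := by omega
    have hmod : ((σ j : ℕ) + t) % m = (i + b) % m := by
      have h1 : (σ j : ℕ) + t + m * e' = i + b + m * e := by linarith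
      have h2 := congrArg (· % m) h1
      simpa only [Nat.add_mul_mod_self_left] using h2
    have h1 := foldCycle_add_mod hm0 (σ j) t
    have h2 := foldCycle_add_mod hm0 i b
    rw [hmod] at h1
    rw [Nat.mod_eq_of_lt (σ j).2] at h1
    rw [Nat.mod_eq_of_lt i.2] at h2
    by_cases ht0 : t = 0
    · subst ht0
      constructor <;> omega
    · constructor <;> omega
  have hBr := Realizes.mulVec_of_band (fun i : Fin m => foldCycle m i)
    (fun i j hij => Fin.ext (foldCycle_injOn i.2 j.2 hij)) (4 * g.natDegree + 2) B hBinj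
    (fun i j hij => (key i j hij).1) (fun i j hij => (key i j hij).2)
  refine ((hBr.comp (Realizes.comp_perm σ.symm)).congr hBM).mono le_rfl ?_ le_rfl
  have hc : (Equiv.Perm.support σ.symm).card ≤ m := (Finset.card_le_univ _).trans (by simp)
  rw [Fintype.card_fin]
  linarith [hc, show (5 * (4 * g.natDegree + 2) + 7) * m = 3 * m +
    (5 * (4 * g.natDegree + 2) + 4) * m by ring]

end IsSparseModulus
end

/-! ### Registers in a memory indexed by ℕ, and Karatsuba multiplication. -/

noncomputable section

/-- The polynomial whose coefficients are the contents of the `n` wires from `x` on. -/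
def reg (x n : ℕ) (v : ℕ → ZMod 2) : (ZMod 2)[X] := ∑ i ∈ Finset.range n, C (v (x + i)) * X ^ i

/-- The state that holds the coefficients of `p` on the wires from `y` on. -/
def put (y : ℕ) (p : (ZMod 2)[X]) : ℕ → ZMod 2 := fun w => if y ≤ w then p.coeff (w - y) else 0

theorem coeff_reg (x n : ℕ) (v : ℕ → ZMod 2) (i : ℕ) :
    (reg x n v).coeff i = if i < n then v (x + i) else 0 := by
  simp [reg, finsetSum_coeff, coeff_X_pow]

theorem coeff_reg_eq_zero {x n : ℕ} {v : ℕ → ZMod 2} {i : ℕ} (hi : n ≤ i) :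
    (reg x n v).coeff i = 0 := by
  rw [coeff_reg, if_neg (by omega)]

theorem reg_add (x n : ℕ) (v w : ℕ → ZMod 2) : reg x n (v + w) = reg x n v + reg x n w := by
  ext i
  simp only [coeff_add, coeff_reg]
  split_ifs <;> simp

theorem reg_congr {x n : ℕ} {v w : ℕ → ZMod 2} (h : ∀ i < n, v (x + i) = w (x + i)) :
    reg x n v = reg x n w := by
  ext i
  simp only [coeff_reg]
  split_ifs with hi
  · exact h i hi
  · rfl

theorem reg_split (x h l : ℕ) (v : ℕ → ZMod 2) :
    reg x (h + l) v = reg x h v + X ^ h * reg (x + h) l v := by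
  ext i
  simp only [coeff_add, coeff_reg, coeff_X_pow_mul']
  by_cases h1 : h ≤ i
  · simp only [h1, if_true, if_neg (show ¬ i < h by omega), zero_add]
    rw [show x + h + (i - h) = x + i by omega]
    congr 1
    simp only [eq_iff_iff]
    omega
  · simp [h1, show i < h by omega, show i < h + l by omega]

theorem put_add (y : ℕ) (p q : (ZMod 2)[X]) : put y (p + q) = put y p + put y q := by
  funext w
  simp only [put, Pi.add_apply, coeff_add]
  split_ifs <;> simp

theorem put_zero (y : ℕ) : put y 0 = 0 := by
  funext w
  simp [put]

theorem put_apply_eq_zero {y k w : ℕ} {p : (ZMod 2)[X]} (hp : ∀ i, k ≤ i → p.coeff i = 0)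
    (hw : w < y ∨ y + k ≤ w) : put y p w = 0 := by
  simp only [put]
  split_ifs with h
  · exact hp _ (by omega)
  · rfl

theorem reg_put_self {x n : ℕ} {p : (ZMod 2)[X]} (hp : ∀ i, n ≤ i → p.coeff i = 0) :
    reg x n (put x p) = p := by
  ext i
  rw [coeff_reg]
  split_ifs with h
  · simp [put]
  · rw [hp i (by omega)]

theorem reg_put_eq_zero {x n y k : ℕ} {p : (ZMod 2)[X]} (hp : ∀ i, k ≤ i → p.coeff i = 0)
    (h : x + n ≤ y ∨ y + k ≤ x) : reg x n (put y p) = 0 := by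
  ext i
  rw [coeff_reg, coeff_zero]
  split_ifs with hi
  · exact put_apply_eq_zero hp (by omega)
  · rfl

theorem reg_add_put {x n y k : ℕ} {p : (ZMod 2)[X]} (v : ℕ → ZMod 2)
    (hp : ∀ i, k ≤ i → p.coeff i = 0) (h : x + n ≤ y ∨ y + k ≤ x) :
    reg x n (v + put y p) = reg x n v := by
  rw [reg_add, reg_put_eq_zero hp h, add_zero]

theorem put_X_pow_mul (c h : ℕ) (p : (ZMod 2)[X]) : put c (X ^ h * p) = put (c + h) p := by
  funext w
  simp only [put, coeff_X_pow_mul']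
  by_cases h1 : c + h ≤ w
  · rw [if_pos (by omega), if_pos (by omega), if_pos h1, Nat.sub_sub]
  · rw [if_neg h1]
    split_ifs with h2 h3
    · omega
    · rfl
    · rfl

theorem put_C_mul_X_pow (y n : ℕ) (a : ZMod 2) : put y (C a * X ^ n) = Pi.single (y + n) a := by
  funext w
  simp only [put, coeff_C_mul, coeff_X_pow, Pi.single_apply]
  by_cases h : w = y + n
  · simp [h]
  · rw [if_neg h]
    split_ifs with h1 h2
    · omega
    · simp
    · rfl

theorem add_self_state (v : ℕ → ZMod 2) : v + v = 0 := by
  funext w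
  exact CharTwo.add_self_eq_zero (v w)

theorem coeff_mul_eq_zero_of_le {p q : (ZMod 2)[X]} {k l : ℕ} (hp : ∀ i, k ≤ i → p.coeff i = 0)
    (hq : ∀ i, l ≤ i → q.coeff i = 0) : ∀ i, k + l ≤ i → (p * q).coeff i = 0 := by
  intro i hi
  rw [coeff_mul]
  refine Finset.sum_eq_zero fun x hx => ?_
  have := Finset.HasAntidiagonal.mem_antidiagonal.1 hx
  rcases (show k ≤ x.1 ∨ l ≤ x.2 by omega) with h | h
  · rw [hp _ h, zero_mul]
  · rw [hq _ h, mul_zero]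

theorem coeff_one_add_X_pow_mul_eq_zero {p : (ZMod 2)[X]} {k : ℕ} (h : ℕ)
    (hp : ∀ i, k ≤ i → p.coeff i = 0) : ∀ i, h + k ≤ i → ((1 + X ^ h) * p).coeff i = 0 := by
  intro i hi
  rw [add_mul, one_mul, coeff_add, coeff_X_pow_mul', if_pos (by omega), hp i (by omega),
    hp (i - h) (by omega), add_zero]

theorem coeff_add_eq_zero_of_le {p q : (ZMod 2)[X]} {k : ℕ} (hp : ∀ i, k ≤ i → p.coeff i = 0)
    (hq : ∀ i, k ≤ i → q.coeff i = 0) : ∀ i, k ≤ i → (p + q).coeff i = 0 := by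
  intro i hi
  rw [coeff_add, hp i hi, hq i hi, add_zero]

namespace Realizes

/-- Adding the register at `x` to the register at `y`.  The registers may overlap if `x < y`. -/
theorem add_reg {N x y : ℕ} (n : ℕ) (hx : x + n ≤ N) (hy : y + n ≤ N) (hxy : x < y ∨ y + n ≤ x) :
    Realizes (Set.Iio N) (fun v => v + put y (reg x n v)) n 0 := by
  induction n with
  | zero => exact of_id (by simp [reg, put_zero])
  | succ n ih =>
    have h1 := ih (by omega) (by omega) (by omega)
    have h2 := add_single (S := Set.Iio N) (a := x + n) (b := y + n) (Set.mem_Iio.2 (by omega))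
      (Set.mem_Iio.2 (by omega)) (by omega)
    -- The top wire is added first, so in the overlapping case a source wire is read before it
    -- changes.
    refine ((h1.comp h2).congr fun v => ?_).mono le_rfl (by omega) le_rfl
    have e1 : reg x (n + 1) v = reg x n v + C (v (x + n)) * X ^ n := by
      simp only [reg, Finset.sum_range_succ]
    have e2 : reg x n (v + Pi.single (y + n) (v (x + n))) = reg x n v := by
      refine reg_congr fun i hi => ?_
      simp [show x + i ≠ y + n by omega]
    rw [e1, e2, put_add, put_C_mul_X_pow]
    abel

/-- Conjugating an addition of `φ` by in-place shifted additions adds `(1 + x ^ h) φ`. -/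
theorem add_one_add_X_pow_mul {N c h n k t : ℕ} {φ : (ℕ → ZMod 2) → (ZMod 2)[X]}
    (hA : Realizes (Set.Iio N) (fun v => v + put c (φ v)) k t)
    (hdeg : ∀ v i, n ≤ i → (φ v).coeff i = 0)
    (hread : ∀ u v : ℕ → ZMod 2, (∀ w, w < c ∨ c + h + n ≤ w → u w = v w) → φ u = φ v)
    (hh : 0 < h) (hN : c + h + n ≤ N) :
    Realizes (Set.Iio N) (fun v => v + put c ((1 + X ^ h) * φ v)) (k + 2 * n) t := by
  -- The shifted addition is linear and sends `put c φ` to `put c ((1 + X ^ h) * φ)`. Running its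
  -- inverse, then the addition of φ, then itself therefore leaves exactly this increment.
  have hM := add_reg (N := N) (x := c) (y := c + h) n (by omega) (by omega) (by omega)
  obtain ⟨G, hG, hG1, hG2⟩ := hM.exists_inverse
  refine ((hM.comp (hA.comp hG)).congr fun v => ?_).mono le_rfl (by omega) (by omega)
  set u := G v with hu
  have hv : u + put (c + h) (reg c n u) = v := hG2 v
  have hφ : φ u = φ v := by
    refine hread _ _ fun w hw => ?_
    rw [← hv, Pi.add_apply, put_apply_eq_zero (fun i hi => coeff_reg_eq_zero hi) (by omega),
      add_zero]
  rw [hφ, reg_add, reg_put_self (hdeg v), put_add, add_mul, one_mul, put_add, put_X_pow_mul]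
  nth_rw 1 [← hv]
  abel

theorem add_reg_mul_aux {N a b c n : ℕ} (hn : n ≤ 1) (ha : a + n ≤ N) (hb : b + n ≤ N)
    (hc : c + 2 * n ≤ N) (hab : a + n ≤ b ∨ b + n ≤ a) (hac : a + n ≤ c ∨ c + 2 * n ≤ a)
    (hbc : b + n ≤ c ∨ c + 2 * n ≤ b) :
    Realizes (Set.Iio N) (fun v => v + put c (reg a n v * reg b n v)) 0 1 := by
  rcases (show n = 0 ∨ n = 1 by omega) with rfl | rfl
  · exact (of_id (by simp [reg, put_zero])).mono le_rfl le_rfl (by omega)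
  · refine (add_single_mul (S := Set.Iio N) (a := a) (b := b) (d := c) (Set.mem_Iio.2 (by omega))
      (Set.mem_Iio.2 (by omega)) (Set.mem_Iio.2 (by omega)) (by omega) (by omega) (by omega)).congr
      fun v => ?_
    have := put_C_mul_X_pow c 0 (v a * v b)
    simp only [pow_zero, mul_one, add_zero, C_mul] at this
    simp [reg, this]

/-- The product of sums of subregisters is added without ancillae. -/
theorem add_mul_of_sums {N a b c h l k t : ℕ} (hl : l ≤ h) (ha : a + h + l ≤ N)
    (hb : b + h + l ≤ N)
    (hab : a + h + l ≤ b ∨ b + h + l ≤ a) (hac : a + h + l ≤ c ∨ c + 2 * h ≤ a)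
    (hbc : b + h + l ≤ c ∨ c + 2 * h ≤ b)
    (hA : Realizes (Set.Iio N) (fun v => v + put c (reg a h v * reg b h v)) k t) :
    Realizes (Set.Iio N) (fun v => v + put c ((reg a h v + reg (a + h) l v) *
      (reg b h v + reg (b + h) l v))) (k + 4 * l) t := by
  -- The high parts are added onto the low parts in place; the same additions remove them after the
  -- product has been taken.
  have hUa := add_reg (N := N) (x := a + h) (y := a) l (by omega) (by omega) (by omega)
  have hUb := add_reg (N := N) (x := b + h) (y := b) l (by omega) (by omega) (by omega)
  refine ((hUa.comp (hUb.comp (hA.comp (hUb.comp hUa)))).congr fun v => ?_).mono le_rfl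
    (by omega) (by omega)
  have hlz : ∀ (x : ℕ) (v : ℕ → ZMod 2) (i : ℕ), l ≤ i → (reg x l v).coeff i = 0 :=
    fun x v i hi => coeff_reg_eq_zero hi
  have hhz : ∀ (x : ℕ) (v : ℕ → ZMod 2) (i : ℕ), h ≤ i → (reg x l v).coeff i = 0 :=
    fun x v i hi => coeff_reg_eq_zero (hl.trans hi)
  set A := reg (a + h) l v with hA'
  set B := reg (b + h) l v with hB'
  have e1 : reg (b + h) l (v + put a A) = B := reg_add_put v (hlz _ _) (by omega)
  rw [e1]
  have e2 : reg a h (v + put a A + put b B) = reg a h v + A := by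
    rw [reg_add_put _ (hlz _ _) (by omega), reg_add, reg_put_self (hhz _ _)]
  have e3 : reg b h (v + put a A + put b B) = reg b h v + B := by
    rw [reg_add, reg_add_put _ (hlz _ _) (by omega), reg_put_self (hhz _ _)]
  rw [e2, e3]
  set P := (reg a h v + A) * (reg b h v + B) with hP
  have hPz : ∀ i, 2 * h ≤ i → P.coeff i = 0 := by
    rw [two_mul]
    exact coeff_mul_eq_zero_of_le
      (coeff_add_eq_zero_of_le (fun i hi => coeff_reg_eq_zero hi) (hhz _ _))
      (coeff_add_eq_zero_of_le (fun i hi => coeff_reg_eq_zero hi) (hhz _ _))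
  have e4 : reg (b + h) l (v + put a A + put b B + put c P) = B := by
    rw [reg_add_put _ hPz (by omega), reg_add_put _ (hlz _ _) (by omega), e1]
  rw [e4]
  have e5 : reg (a + h) l (v + put a A + put b B + put c P + put b B) = A := by
    rw [reg_add_put _ (hlz _ _) (by omega), reg_add_put _ hPz (by omega),
      reg_add_put _ (hlz _ _) (by omega), reg_add_put _ (hlz _ _) (by omega)]
  rw [e5]
  have e6 := add_self_state (put a A)
  have e7 := add_self_state (put b B)
  linear_combination -e6 - e7

/-- Karatsuba multiplication of polynomials, in place and without ancillae. -/
theorem add_reg_mul (r : ℕ) : ∀ {N a b c n : ℕ}, n ≤ 2 ^ r → a + n ≤ N → b + n ≤ N →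
    c + 2 * n ≤ N → (a + n ≤ b ∨ b + n ≤ a) → (a + n ≤ c ∨ c + 2 * n ≤ a) →
    (b + n ≤ c ∨ c + 2 * n ≤ b) →
    Realizes (Set.Iio N) (fun v => v + put c (reg a n v * reg b n v))
      (12 * 3 ^ r - 12 * 2 ^ r) (3 ^ r) := by
  induction r with
  | zero =>
    intro N a b c n hn ha hb hc hab hac hbc
    exact (add_reg_mul_aux hn ha hb hc hab hac hbc).mono le_rfl (by simp) (by simp)
  | succ r ih =>
    intro N a b c n hn ha hb hc hab hac hbc
    by_cases hn1 : n ≤ 1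
    · exact (add_reg_mul_aux hn1 ha hb hc hab hac hbc).mono le_rfl (Nat.zero_le _)
        (Nat.one_le_pow _ _ (by norm_num))
    -- The bound h ≤ 2l is needed because (1 + X^h) a₀b₀ is built on 3h wires, which have to fit
    -- into the 2(h + l) wires of the target.
    obtain ⟨h, l, hl, rfl, hh, hhl⟩ : ∃ h l, l ≤ h ∧ n = h + l ∧ h ≤ 2 ^ r ∧ h ≤ 2 * l :=
      ⟨(n + 1) / 2, n / 2, by omega, by omega, by rw [pow_succ] at hn; omega, by omega⟩
    have h1 := (ih (N := N) (a := a) (b := b) (c := c) (n := h) hh (by omega) (by omega) (by omega)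
      (by omega) (by omega) (by omega)).add_one_add_X_pow_mul (h := h) (n := h + h)
      (fun v => coeff_mul_eq_zero_of_le (fun i hi => coeff_reg_eq_zero hi)
        fun i hi => coeff_reg_eq_zero hi) (fun u v huv => by
        rw [reg_congr fun i hi => huv (a + i) (by omega),
          reg_congr fun i hi => huv (b + i) (by omega)]) (by omega) (by omega)
    have h2 := (ih (N := N) (a := a + h) (b := b + h) (c := c + h) (n := l) (by omega) (by omega)
      (by omega) (by omega) (by omega) (by omega) (by omega)).add_one_add_X_pow_mul (h := h)
      (n := l + l) (fun v => coeff_mul_eq_zero_of_le (fun i hi => coeff_reg_eq_zero hi)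
        fun i hi => coeff_reg_eq_zero hi) (fun u v huv => by
        rw [reg_congr fun i hi => huv (a + h + i) (by omega),
          reg_congr fun i hi => huv (b + h + i) (by omega)]) (by omega) (by omega)
    have h3 := (ih (N := N) (a := a) (b := b) (c := c + h) (n := h) hh (by omega) (by omega)
      (by omega) (by omega) (by omega) (by omega)).add_mul_of_sums (l := l) hl (by omega) (by omega)
      (by omega) (by omega) (by omega)
    -- The identity used, in characteristic 2, is ab = (1 + X^h) a₀b₀ + X^h (1 + X^h) a₁b₁ + X^h (a₀
    -- + a₁)(b₀ + b₁).
    refine ((h3.comp (h2.comp h1)).congr fun v => ?_).mono le_rfl ?_ ?_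
    · have hz : ∀ (x k : ℕ) (v : ℕ → ZMod 2) (i : ℕ), k ≤ i → (reg x k v).coeff i = 0 :=
        fun x k v i hi => coeff_reg_eq_zero hi
      have p1 : ∀ i, h + h + l + l ≤ i →
          ((1 + X ^ h) * (reg a h v * reg b h v)).coeff i = 0 := fun i hi =>
        coeff_one_add_X_pow_mul_eq_zero h (coeff_mul_eq_zero_of_le (hz _ _ _) (hz _ _ _)) i
          (by omega)
      have p2 : ∀ i, h + l + l ≤ i →
          ((1 + X ^ h) * (reg (a + h) l v * reg (b + h) l v)).coeff i = 0 := fun i hi =>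
        coeff_one_add_X_pow_mul_eq_zero h (coeff_mul_eq_zero_of_le (hz _ _ _) (hz _ _ _)) i
          (by omega)
      have e1 : ∀ x k, (x + k ≤ c ∨ c + (h + h + l + l) ≤ x) →
          reg x k (v + put c ((1 + X ^ h) * (reg a h v * reg b h v))) = reg x k v :=
        fun x k hx => reg_add_put v p1 hx
      rw [e1 _ _ (by omega), e1 _ _ (by omega)]
      have e2 : ∀ x k, (x + k ≤ c ∨ c + (h + h + l + l) ≤ x) →
          reg x k (v + put c ((1 + X ^ h) * (reg a h v * reg b h v)) +
            put (c + h) ((1 + X ^ h) * (reg (a + h) l v * reg (b + h) l v))) = reg x k v :=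
        fun x k hx => by rw [reg_add_put _ p2 (by omega), e1 x k hx]
      rw [e2 _ _ (by omega), e2 _ _ (by omega), e2 _ _ (by omega), e2 _ _ (by omega),
        reg_split, reg_split, ← put_X_pow_mul, ← put_X_pow_mul, add_assoc, add_assoc, ← put_add,
        ← put_add]
      congr 2
      have e3 := CharTwo.add_self_eq_zero (X ^ h * (reg a h v * reg b h v))
      have e4 := CharTwo.add_self_eq_zero (X ^ h * (reg (a + h) l v * reg (b + h) l v))
      linear_combination -e3 - e4
    -- A level adds 4h + 8l ≤ 12 · 2^r CNOT gates to three recursive calls, and 12 · 3^r - 12 · 2^r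
    -- solves this recurrence exactly.
    · have hpow : 2 ^ r ≤ 3 ^ r := Nat.pow_le_pow_left (by norm_num) r
      rw [pow_succ, pow_succ]
      omega
    · rw [pow_succ]
      omega

end Realizes
end

/-! ### Out-of-place linear maps and the method of the four Russians. -/

noncomputable section

theorem put_eq_sum {y k : ℕ} {p : (ZMod 2)[X]} (hp : ∀ i, k ≤ i → p.coeff i = 0) :
    put y p = ∑ i ∈ Finset.range k, Pi.single (y + i) (p.coeff i) := by
  funext w
  rw [Finset.sum_apply]
  simp only [Pi.single_apply]
  by_cases hw : y ≤ w ∧ w < y + k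
  · rw [Finset.sum_eq_single (w - y)]
    · simp [put, hw.1, show y + (w - y) = w by omega]
    · intro i _ hi
      rw [if_neg (by omega)]
    · intro hi
      exact absurd (Finset.mem_range.2 (by omega)) hi
  · rw [put_apply_eq_zero hp (by omega), Finset.sum_eq_zero]
    intro i hi
    rw [if_neg (by have := Finset.mem_range.1 hi; omega)]

theorem coeff_sum_C_mul_eq_zero {ι : Type*} {s : Finset ι} {P : ι → (ZMod 2)[X]} {k : ℕ}
    (hP : ∀ j ∈ s, ∀ i, k ≤ i → (P j).coeff i = 0) (a : ι → ZMod 2) :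
    ∀ i, k ≤ i → (∑ j ∈ s, C (a j) * P j).coeff i = 0 := by
  intro i hi
  rw [finsetSum_coeff]
  refine Finset.sum_eq_zero fun j hj => ?_
  rw [coeff_C_mul, hP j hj i hi, mul_zero]

theorem put_sum {ι : Type*} (y : ℕ) (s : Finset ι) (P : ι → (ZMod 2)[X]) :
    put y (∑ j ∈ s, P j) = ∑ j ∈ s, put y (P j) := by
  classical
  induction s using Finset.induction_on with
  | empty => simp [put_zero]
  | insert a s ha ih => rw [Finset.sum_insert ha, Finset.sum_insert ha, put_add, ih]

namespace Realizes

theorem add_parity_shift {N x y : ℕ} (A B : Finset ℕ) (hA : ∀ a ∈ A, x + a < N)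
    (hB : ∀ b ∈ B, y + b < N) (hAB : ∀ a ∈ A, ∀ b ∈ B, x + a ≠ y + b) :
    Realizes (Set.Iio N) (fun v => v + ∑ b ∈ B, Pi.single (y + b) (∑ a ∈ A, v (x + a)))
      (2 * A.card + B.card) 0 := by
  have := add_parity (S := Set.Iio N) (A.map (addLeftEmbedding x)) (B.map (addLeftEmbedding y))
    (by intro w hw; simp at hw; obtain ⟨a, ha, rfl⟩ := hw; exact hA a ha)
    (by intro w hw; simp at hw; obtain ⟨a, ha, rfl⟩ := hw; exact hB a ha)
    (by
      rw [Finset.disjoint_left]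
      intro w hw hw'
      simp only [Finset.mem_map, addLeftEmbedding_apply] at hw hw'
      obtain ⟨a, ha, rfl⟩ := hw
      obtain ⟨b, hb, hb'⟩ := hw'
      exact hAB a ha b hb hb'.symm)
  simpa only [Finset.sum_map, Finset.card_map, addLeftEmbedding_apply] using this

/-- Out-of-place application of a linear map, column by column. -/
theorem add_linear {N x y n k : ℕ} {P : ℕ → (ZMod 2)[X]}
    (hP : ∀ j < n, ∀ i, k ≤ i → (P j).coeff i = 0) (hx : x + n ≤ N) (hy : y + k ≤ N)
    (hxy : x + n ≤ y ∨ y + k ≤ x) :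
    Realizes (Set.Iio N) (fun v => v + put y (∑ j ∈ Finset.range n, C (v (x + j)) * P j))
      (∑ j ∈ Finset.range n, (2 + (P j).support.card)) 0 := by
  have hsupp : ∀ j < n, ∀ i ∈ (P j).support, i < k := by
    intro j hj i hi
    by_contra hcon
    exact mem_support_iff.1 hi (hP j hj i (by omega))
  have hz : ∀ j < n, ∀ a : ZMod 2, ∀ i, k ≤ i → (C a * P j).coeff i = 0 := by
    intro j hj a i hi
    rw [coeff_C_mul, hP j hj i hi, mul_zero]
  refine ((add_sum (S := Set.Iio N) (Finset.range n) (fun j v => put y (C (v (x + j)) * P j))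
    (Set.Ico x (x + n)) (fun j => 2 + (P j).support.card) (fun _ => 0) ?_ ?_ ?_).congr
    fun v => by rw [put_sum]).mono le_rfl le_rfl (by simp)
  · intro j hj
    rw [Finset.mem_range] at hj
    refine ((add_parity_shift (N := N) (x := x) (y := y) {j} (P j).support ?_ ?_ ?_).congr
      fun v => ?_).mono le_rfl (by simp) le_rfl
    · simp; omega
    · intro i hi
      have := hsupp j hj i hi
      omega
    · simp only [Finset.mem_singleton, forall_eq]
      intro i hi
      have := hsupp j hj i hi
      omega
    · congr 1
      rw [put_eq_sum (hz j hj _), Finset.sum_singleton]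
      refine (Finset.sum_subset_zero_on_sdiff (fun i hi => Finset.mem_range.2 (hsupp j hj i hi))
        (fun i hi => ?_) fun i hi => ?_).symm
      · rw [Finset.mem_sdiff, notMem_support_iff] at hi
        simp [hi.2]
      · rw [coeff_C_mul, ZMod.eq_one_of_ne_zero_two _ (mem_support_iff.1 hi), mul_one]
  · intro j hj v v' hv
    rw [Finset.mem_range] at hj
    rw [hv (show x + j ∈ Set.Ico x (x + n) from ⟨by omega, by omega⟩)]
  · intro j hj v w hw
    rw [Finset.mem_range] at hj
    have := hw.1
    have := hw.2
    exact put_apply_eq_zero (hz j hj _) (by omega)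

/-- Output wires are grouped by the subset of the block `J` whose parity they receive. Each of the
at most 2^s subsets has its parity gathered once, with at most 2s gates, and each of the `k` output
wires belongs to exactly one group. -/
theorem add_linear_block {N x y n k s : ℕ} {P : ℕ → (ZMod 2)[X]} (J : Finset ℕ)
    (hJ : ∀ j ∈ J, j < n) (hs : J.card ≤ s) (hP : ∀ j < n, ∀ i, k ≤ i → (P j).coeff i = 0)
    (hx : x + n ≤ N) (hy : y + k ≤ N) (hxy : x + n ≤ y ∨ y + k ≤ x) :
    Realizes (Set.Iio N) (fun v => v + put y (∑ j ∈ J, C (v (x + j)) * P j))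
      (2 * s * 2 ^ s + k) 0 := by
  set T : ℕ → Finset ℕ := fun i => J.filter fun j => (P j).coeff i ≠ 0 with hT
  set I : Finset ℕ → Finset ℕ := fun p => (Finset.range k).filter fun i => T i = p with hI
  have hmaps : ∀ i ∈ Finset.range k, T i ∈ J.powerset := fun i _ =>
    Finset.mem_powerset.2 (Finset.filter_subset _ _)
  have hIk : ∀ p, ∀ i ∈ I p, i < k := fun p i hi =>
    Finset.mem_range.1 (Finset.mem_of_mem_filter i hi)
  have hpn : ∀ p ∈ J.powerset, ∀ j ∈ p, j < n := fun p hp j hj =>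
    hJ j (Finset.mem_powerset.1 hp hj)
  have hsum := add_sum (S := Set.Iio N) J.powerset
    (fun p v => ∑ i ∈ I p, Pi.single (y + i) (∑ j ∈ p, v (x + j)))
    (Set.Ico x (x + n)) (fun p => 2 * p.card + (I p).card) (fun _ => 0) ?_ ?_ ?_
  · refine (hsum.congr fun v => ?_).mono le_rfl ?_ (by simp)
    · congr 1
      have h1 : ∀ p, ∑ i ∈ I p, (Pi.single (y + i) (∑ j ∈ p, v (x + j)) : ℕ → ZMod 2)
          = ∑ i ∈ I p, Pi.single (y + i) (∑ j ∈ T i, v (x + j)) := by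
        intro p
        refine Finset.sum_congr rfl fun i hi => ?_
        rw [(Finset.mem_filter.1 hi).2]
      simp only [h1]
      rw [hI, Finset.sum_fiberwise_of_maps_to hmaps,
        put_eq_sum (coeff_sum_C_mul_eq_zero (fun j hj => hP j (hJ j hj)) _)]
      refine Finset.sum_congr rfl fun i _ => ?_
      rw [hT, ZMod.sum_filter_ne_zero_eq_sum_mul J (fun j => (P j).coeff i) fun j => v (x + j),
        finsetSum_coeff]
      congr 1
      refine Finset.sum_congr rfl fun j _ => ?_
      rw [coeff_C_mul, mul_comm]
    · rw [Finset.sum_add_distrib, hI, ← Finset.card_eq_sum_card_fiberwise hmaps, Finset.card_range]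
      gcongr
      calc ∑ p ∈ J.powerset, 2 * p.card ≤ ∑ _p ∈ J.powerset, 2 * s := by
            gcongr with p hp
            exact (Finset.card_le_card (Finset.mem_powerset.1 hp)).trans hs
        _ = 2 ^ J.card * (2 * s) := by rw [Finset.sum_const, Finset.card_powerset, smul_eq_mul]
        _ ≤ 2 * s * 2 ^ s := by
            rw [mul_comm]
            gcongr
            norm_num
  · intro p hp
    refine add_parity_shift p (I p) (fun a ha => ?_) (fun i hi => ?_) fun a ha i hi => ?_
    · have := hpn p hp a ha; omega
    · have := hIk p i hi; omega
    · have := hpn p hp a ha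
      have := hIk p i hi
      omega
  · intro p hp v v' hv
    rw [Finset.sum_congr rfl fun j hj => hv (show x + j ∈ Set.Ico x (x + n) from
      ⟨by omega, by have := hpn p hp j hj; omega⟩)]
  · intro p hp v w hw
    rw [Finset.sum_apply]
    refine Finset.sum_eq_zero fun i hi => ?_
    have := hIk p i hi
    have := hw.1
    have := hw.2
    rw [Pi.single_apply, if_neg (by omega)]

/-- Out-of-place application of a linear map by the method of the four Russians, with blocks of
`s` columns. -/
theorem add_linear_blocks {N x y n k s : ℕ} {P : ℕ → (ZMod 2)[X]} (hs : 0 < s)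
    (hP : ∀ j < n, ∀ i, k ≤ i → (P j).coeff i = 0) (hx : x + n ≤ N) (hy : y + k ≤ N)
    (hxy : x + n ≤ y ∨ y + k ≤ x) :
    Realizes (Set.Iio N) (fun v => v + put y (∑ j ∈ Finset.range n, C (v (x + j)) * P j))
      ((n / s + 1) * (2 * s * 2 ^ s + k)) 0 := by
  set J : ℕ → Finset ℕ := fun q => (Finset.range n).filter fun j => j / s = q with hJ
  have hmaps : ∀ j ∈ Finset.range n, j / s ∈ Finset.range (n / s + 1) := by
    intro j hj
    rw [Finset.mem_range] at hj ⊢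
    exact Nat.lt_succ_of_le (Nat.div_le_div_right hj.le)
  have hJn : ∀ q, ∀ j ∈ J q, j < n := fun q j hj =>
    Finset.mem_range.1 (Finset.mem_of_mem_filter j hj)
  have hJs : ∀ q, (J q).card ≤ s := by
    intro q
    calc (J q).card ≤ (Finset.Ico (s * q) (s * q + s)).card := by
          refine Finset.card_le_card fun j hj => ?_
          obtain rfl := (Finset.mem_filter.1 hj).2
          have h1 := Nat.div_add_mod j s
          have h2 := Nat.mod_lt j hs
          rw [Finset.mem_Ico]
          omega
      _ = s := by simp
  have hz : ∀ q (v : ℕ → ZMod 2), ∀ i, k ≤ i → (∑ j ∈ J q, C (v (x + j)) * P j).coeff i = 0 :=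
    fun q v => coeff_sum_C_mul_eq_zero (fun j hj => hP j (hJn q j hj)) _
  refine ((add_sum (S := Set.Iio N) (Finset.range (n / s + 1))
    (fun q v => put y (∑ j ∈ J q, C (v (x + j)) * P j)) (Set.Ico x (x + n))
    (fun _ => 2 * s * 2 ^ s + k) (fun _ => 0)
    (fun q _ => add_linear_block (J q) (hJn q) (hJs q) hP hx hy hxy) ?_ ?_).congr
    fun v => ?_).mono le_rfl (by simp) (by simp)
  · intro q _ v v' hv
    congr 1
    refine Finset.sum_congr rfl fun j hj => ?_
    rw [hv (show x + j ∈ Set.Ico x (x + n) from ⟨by omega, by have := hJn q j hj; omega⟩)]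
  · intro q _ v w hw
    have := hw.1
    have := hw.2
    exact put_apply_eq_zero (hz q v) (by omega)
  · rw [← put_sum, hJ, Finset.sum_fiberwise_of_maps_to hmaps]

end Realizes

/-! ### Field operations on registers modulo f. -/

namespace AdjoinRoot

variable {f : (ZMod 2)[X]} (hf : f.Monic)

theorem modByMonicHom_map_mk_reg (φ : AdjoinRoot f →+ AdjoinRoot f) (x n : ℕ) (v : ℕ → ZMod 2) :
    modByMonicHom hf (φ (mk f (reg x n v)))
      = ∑ j ∈ Finset.range n, C (v (x + j)) * modByMonicHom hf (φ (root f ^ j)) := by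
  rw [reg, map_sum, map_sum, map_sum]
  refine Finset.sum_congr rfl fun j _ => ?_
  rw [map_mul, mk_C, map_pow, mk_X, map_of_mul]
  rw [show of f (v (x + j)) = algebraMap (ZMod 2) (AdjoinRoot f) (v (x + j)) from rfl,
    ← Algebra.smul_def, map_smul, smul_eq_C_mul]

end AdjoinRoot

namespace IsSparseModulus

open AdjoinRoot

variable {f g : (ZMod 2)[X]} {m : ℕ} (h : IsSparseModulus f g m)
include h

theorem coeff_modByMonicHom_eq_zero (y : AdjoinRoot f) :
    ∀ i, m ≤ i → (modByMonicHom h.monic y).coeff i = 0 := fun i hi =>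
  AdjoinRoot.coeff_modByMonicHom_eq_zero h.monic y (by rwa [h.natDegree_eq])

theorem card_support_root_pow_le {k : ℕ} (hk : k < 2 * m) :
    (modByMonicHom h.monic (root f ^ k)).support.card ≤ 6 * g.natDegree + 3 := by
  rcases lt_or_ge m (2 * g.natDegree) with hd | hd
  · calc _ ≤ (Finset.range m).card := by
          refine Finset.card_le_card fun i hi => Finset.mem_range.2 ?_
          by_contra hcon
          exact mem_support_iff.1 hi (h.coeff_modByMonicHom_eq_zero _ i (by omega))
      _ ≤ _ := by rw [Finset.card_range]; omega
  · calc _ ≤ ((Finset.range (2 * g.natDegree + 1) ×ˢ Finset.range 3).image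
            fun p => k + p.1 - p.2 * m).card := by
          refine Finset.card_le_card fun i hi => ?_
          obtain ⟨t, ht, e, he, hte⟩ := h.coeff_root_pow hd hk (mem_support_iff.1 hi)
          refine Finset.mem_image.2 ⟨(t, e), ?_, by simp only; omega⟩
          simp only [Finset.mem_product, Finset.mem_range]
          omega
      _ ≤ (Finset.range (2 * g.natDegree + 1) ×ˢ Finset.range 3).card := Finset.card_image_le
      _ ≤ _ := by rw [Finset.card_product, Finset.card_range, Finset.card_range]; omega

theorem mk_reg_add_put {x : ℕ} (v : ℕ → ZMod 2) (y : AdjoinRoot f) :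
    AdjoinRoot.mk f (reg x m (v + put x (modByMonicHom h.monic y)))
      = AdjoinRoot.mk f (reg x m v) + y := by
  rw [reg_add, reg_put_self (h.coeff_modByMonicHom_eq_zero y), map_add, mk_modByMonicHom]

theorem reg_add_put_of_disjoint {x n y : ℕ} (v : ℕ → ZMod 2) (z : AdjoinRoot f)
    (hxy : x + n ≤ y ∨ y + m ≤ x) :
    reg x n (v + put y (modByMonicHom h.monic z)) = reg x n v :=
  reg_add_put v (h.coeff_modByMonicHom_eq_zero z) hxy

theorem mk_reg_injective {x : ℕ} {v w : ℕ → ZMod 2}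
    (hvw : AdjoinRoot.mk f (reg x m v) = AdjoinRoot.mk f (reg x m w)) : reg x m v = reg x m w := by
  have hd : ∀ v, (reg x m v).degree < f.degree := by
    intro v
    rw [h.degree_eq, degree_lt_iff_coeff_zero]
    exact fun i hi => coeff_reg_eq_zero hi
  have h1 := congrArg (modByMonicHom h.monic) hvw
  rwa [modByMonicHom_mk_of_degree_lt h.monic (hd v),
    modByMonicHom_mk_of_degree_lt h.monic (hd w)] at h1

/-- The m bits of a register are determined by the field element they represent, so states can be
compared through field identities. -/
theorem state_ext {x : ℕ} {v w : ℕ → ZMod 2} (h1 : ∀ i, i < x ∨ x + m ≤ i → v i = w i)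
    (h2 : AdjoinRoot.mk f (reg x m v) = AdjoinRoot.mk f (reg x m w)) : v = w := by
  funext i
  by_cases hi : i < x ∨ x + m ≤ i
  · exact h1 i hi
  · have h3 := congrArg (fun p => coeff p (i - x)) (h.mk_reg_injective h2)
    simp only [coeff_reg] at h3
    rwa [if_pos (by omega), if_pos (by omega), show x + (i - x) = i by omega] at h3

/-- Reduction of a double-length register modulo `f`. -/
theorem realizes_add_mod {N t c : ℕ} (ht : t + 2 * m ≤ N) (hc : c + m ≤ N)
    (htc : t + 2 * m ≤ c ∨ c + m ≤ t) :
    Realizes (Set.Iio N) (fun v => v + put c (modByMonicHom h.monic (AdjoinRoot.mk f (reg t (2 * m) v))))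
      (2 * m * (6 * g.natDegree + 5)) 0 := by
  refine ((Realizes.add_linear (N := N) (P := fun j => modByMonicHom h.monic (root f ^ j))
    (fun _ _ => h.coeff_modByMonicHom_eq_zero _) ht hc htc).congr fun v => ?_).mono le_rfl ?_ le_rfl
  · exact congrArg (fun p => v + put c p)
      (modByMonicHom_map_mk_reg h.monic (AddMonoidHom.id _) t (2 * m) v)
  · calc _ ≤ ∑ _j ∈ Finset.range (2 * m), (6 * g.natDegree + 5) := by
          refine Finset.sum_le_sum fun j hj => ?_
          have := h.card_support_root_pow_le (Finset.mem_range.1 hj)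
          omega
      _ = _ := by simp

/-- Multiplication in `𝔽₂[x]/(f)`; the `2 * m` wires from `t` on are used as scratch space and may
have any contents. -/
theorem realizes_add_mul {N a b c t r : ℕ} (hr : m ≤ 2 ^ r) (ha : a + m ≤ N) (hb : b + m ≤ N)
    (hc : c + m ≤ N) (ht : t + 2 * m ≤ N) (hab : a + m ≤ b ∨ b + m ≤ a)
    (hac : a + m ≤ c ∨ c + m ≤ a) (hbc : b + m ≤ c ∨ c + m ≤ b)
    (hta : t + 2 * m ≤ a ∨ a + m ≤ t) (htb : t + 2 * m ≤ b ∨ b + m ≤ t)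
    (htc : t + 2 * m ≤ c ∨ c + m ≤ t) :
    Realizes (Set.Iio N) (fun v => v + put c (modByMonicHom h.monic
      (AdjoinRoot.mk f (reg a m v) * AdjoinRoot.mk f (reg b m v))))
      (24 * 3 ^ r + 4 * m * (6 * g.natDegree + 5)) (2 * 3 ^ r) := by
  have hR := h.realizes_add_mod ht hc htc
  have hA := Realizes.add_reg_mul r (N := N) (a := a) (b := b) (c := t) (n := m) hr ha hb ht hab
    (by omega) (by omega)
  have hpz : ∀ v i, 2 * m ≤ i → (reg a m v * reg b m v).coeff i = 0 := by
    intro v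
    rw [two_mul]
    exact coeff_mul_eq_zero_of_le (fun i hi => coeff_reg_eq_zero hi)
      fun i hi => coeff_reg_eq_zero hi
  -- The order is: reduce, multiply, reduce, multiply. The old scratch contents enter the target
  -- twice and the product enters the scratch wires twice; both cancel, and only the reduced product
  -- remains in the target.
  refine ((hA.comp (hR.comp (hA.comp hR))).congr fun v => ?_).mono le_rfl ?_ ?_
  · set R := put c (modByMonicHom h.monic (AdjoinRoot.mk f (reg t (2 * m) v))) with hRdef
    have e1 : ∀ x n, (x + n ≤ c ∨ c + m ≤ x) → reg x n (v + R) = reg x n v :=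
      fun x n hx => h.reg_add_put_of_disjoint v _ hx
    rw [e1 a m hac, e1 b m hbc]
    set A := reg a m v * reg b m v with hAdef
    have hAz : ∀ i, 2 * m ≤ i → A.coeff i = 0 := hpz v
    have e2 : reg t (2 * m) (v + R + put t A) = reg t (2 * m) v + A := by
      rw [reg_add, e1 t (2 * m) htc, reg_put_self hAz]
    rw [e2]
    have e3 : ∀ x z, (x + m ≤ c ∨ c + m ≤ x) → (x + m ≤ t ∨ t + 2 * m ≤ x) →
        reg x m (v + R + put t A + put c (modByMonicHom h.monic z)) = reg x m v := by
      intro x z hxc hxt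
      rw [h.reg_add_put_of_disjoint _ _ hxc, reg_add_put _ hAz hxt, e1 x m hxc]
    rw [e3 a _ hac (by omega), e3 b _ hbc (by omega), ← hAdef, ← map_mul, ← hAdef, map_add,
      map_add, put_add, ← hRdef]
    have e4 := add_self_state R
    have e5 := add_self_state (put t A)
    linear_combination -e4 - e5
  · have h1 : 2 ^ r ≤ 3 ^ r := Nat.pow_le_pow_left (by norm_num) r
    have h2 : 4 * m * (6 * g.natDegree + 5) = 2 * (2 * m * (6 * g.natDegree + 5)) := by ring
    omega
  · omega

/-- Out-of-place application of an additive map by the method of the four Russians. -/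
theorem realizes_add_map (φ : AdjoinRoot f →+ AdjoinRoot f) {N x y s : ℕ} (hs : 0 < s)
    (hx : x + m ≤ N) (hy : y + m ≤ N) (hxy : x + m ≤ y ∨ y + m ≤ x) :
    Realizes (Set.Iio N) (fun v => v + put y (modByMonicHom h.monic (φ (AdjoinRoot.mk f (reg x m v)))))
      ((m / s + 1) * (2 * s * 2 ^ s + m)) 0 :=
  (Realizes.add_linear_blocks (N := N) (P := fun j => modByMonicHom h.monic (φ (root f ^ j))) hs
    (fun _ _ => h.coeff_modByMonicHom_eq_zero _) hx hy hxy).congr fun v =>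
      congrArg (fun p => v + put y p) (modByMonicHom_map_mk_reg h.monic φ x m v)

/-- The transformation that replaces the contents `a` of a register by `F a`. -/
def inPlace (x : ℕ) (F : AdjoinRoot f → AdjoinRoot f) (v : ℕ → ZMod 2) : ℕ → ZMod 2 :=
  fun w => if x ≤ w ∧ w < x + m then
    (modByMonicHom h.monic (F (AdjoinRoot.mk f (reg x m v)))).coeff (w - x) else v w

theorem inPlace_apply_of_notMem {x w : ℕ} (F : AdjoinRoot f → AdjoinRoot f) (v : ℕ → ZMod 2)
    (hw : w < x ∨ x + m ≤ w) : h.inPlace x F v w = v w := by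
  rw [inPlace, if_neg (by omega)]

theorem mk_reg_inPlace (x : ℕ) (F : AdjoinRoot f → AdjoinRoot f) (v : ℕ → ZMod 2) :
    AdjoinRoot.mk f (reg x m (h.inPlace x F v)) = F (AdjoinRoot.mk f (reg x m v)) := by
  conv_rhs => rw [← mk_modByMonicHom h.monic (F (AdjoinRoot.mk f (reg x m v)))]
  congr 1
  ext i
  rw [coeff_reg]
  split_ifs with hi
  · simp [inPlace, hi]
  · rw [h.coeff_modByMonicHom_eq_zero _ i (by omega)]

theorem inPlace_inPlace (x : ℕ) (F G : AdjoinRoot f → AdjoinRoot f) (v : ℕ → ZMod 2) :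
    h.inPlace x G (h.inPlace x F v) = h.inPlace x (fun a => G (F a)) v := by
  refine h.state_ext (x := x) (fun i hi => ?_) ?_
  · rw [h.inPlace_apply_of_notMem _ _ hi, h.inPlace_apply_of_notMem _ _ hi,
      h.inPlace_apply_of_notMem _ _ hi]
  · simp only [h.mk_reg_inPlace]

theorem realizes_inPlace_sq [Fact (Irreducible f)] {N x : ℕ} (hx : x + m ≤ N) :
    Realizes (Set.Iio N) (h.inPlace x fun a => a ^ 2)
      ((5 * (4 * g.natDegree + 2) + 7) * m) 0 := by
  set e : Fin m ↪ ℕ := ⟨fun i => x + i, fun i j hij => Fin.ext (by simpa using hij)⟩ with he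
  have hreg : ∀ v : ℕ → ZMod 2, AdjoinRoot.mk f (reg x m v) = fieldElem f (v ∘ e) := by
    intro v
    rw [fieldElem_eq_mk, reg, Finset.sum_range]
    rfl
  have hrange : ∀ w, w ∈ Set.range e ↔ x ≤ w ∧ w < x + m := by
    intro w
    constructor
    · rintro ⟨i, rfl⟩
      exact ⟨Nat.le_add_right x i, Nat.add_lt_add_left i.2 x⟩
    · rintro ⟨h1, h2⟩
      exact ⟨⟨w - x, by omega⟩, Nat.add_sub_of_le h1⟩
  refine (h.realizes_frobenius.map e (H := h.inPlace x fun a => a ^ 2) ?_ ?_).mono ?_ le_rfl le_rfl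
  · intro v i
    have h1 : h.inPlace x (fun a => a ^ 2) v ∘ e = (powMatrix h.monic (frobenius (AdjoinRoot f) 2 :
        AdjoinRoot f →+ AdjoinRoot f) m).mulVec (v ∘ e) := by
      apply fieldElem_injective h.monic h.natDegree_eq
      rw [← hreg, h.mk_reg_inPlace, hreg]
      exact (fieldElem_powMatrix_mulVec h.monic (frobenius (AdjoinRoot f) 2 :
        AdjoinRoot f →+ AdjoinRoot f) h.natDegree_eq (v ∘ e)).symm
    exact congrFun h1 i
  · intro v w hw
    exact h.inPlace_apply_of_notMem _ _ (by rw [hrange] at hw; omega)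
  · intro w hw
    rw [hrange] at hw
    exact Set.mem_Iio.2 (by omega)

theorem realizes_inPlace_pow [Fact (Irreducible f)] {N x : ℕ} (hx : x + m ≤ N) (k : ℕ) :
    Realizes (Set.Iio N) (h.inPlace x fun a => a ^ 2 ^ k)
      (k * ((5 * (4 * g.natDegree + 2) + 7) * m)) 0 := by
  induction k with
  | zero =>
    refine (Realizes.of_id fun v => h.state_ext (x := x) (fun i hi => ?_) ?_).mono le_rfl
      (Nat.zero_le _) le_rfl
    · exact h.inPlace_apply_of_notMem _ _ hi
    · simp [h.mk_reg_inPlace]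
  | succ k ih =>
    refine (((h.realizes_inPlace_sq hx).comp ih).congr fun v => ?_).mono le_rfl
      (Nat.succ_mul _ _).ge le_rfl
    rw [h.inPlace_inPlace]
    congr 1
    funext a
    rw [pow_succ, pow_mul]

/-- Out-of-place computation of a power of the Frobenius by repeated squaring. -/
theorem realizes_add_pow [Fact (Irreducible f)] {N x y : ℕ} (k : ℕ) (hx : x + m ≤ N)
    (hy : y + m ≤ N) (hxy : x + m ≤ y ∨ y + m ≤ x) :
    Realizes (Set.Iio N) (fun v => v + put y (modByMonicHom h.monic
      (AdjoinRoot.mk f (reg x m v) ^ 2 ^ k)))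
      (2 * (k * ((5 * (4 * g.natDegree + 2) + 7) * m)) + m) 0 := by
  have hm0 : 0 < m := (Nat.zero_le _).trans_lt h.lt
  have hI := h.realizes_inPlace_pow hy k
  -- The target is replaced by its 2^k-th root, the source is added, and the 2^k-th power is taken.
  -- Additivity of the Frobenius turns this into the addition of the 2^k-th power of the source.
  obtain ⟨G, hG, -, hG2⟩ := hI.exists_inverse
  have hC := Realizes.add_reg (N := N) (x := x) (y := y) m hx hy (by omega)
  refine ((hI.comp (hC.comp hG)).congr fun v => ?_).mono le_rfl (by omega) le_rfl
  set u := G v with hu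
  have hv : h.inPlace y (fun a => a ^ 2 ^ k) u = v := hG2 v
  have hoff : ∀ i, i < y ∨ y + m ≤ i → u i = v i := by
    intro i hi
    rw [← hv, h.inPlace_apply_of_notMem _ _ hi]
  have hreg : reg x m u = reg x m v := reg_congr fun i hi => hoff _ (by omega)
  have hely : AdjoinRoot.mk f (reg y m v) = AdjoinRoot.mk f (reg y m u) ^ 2 ^ k := by
    rw [← hv, h.mk_reg_inPlace]
  refine h.state_ext (x := y) (fun i hi => ?_) ?_
  · rw [h.inPlace_apply_of_notMem _ _ hi, Pi.add_apply, Pi.add_apply,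
      put_apply_eq_zero (h.coeff_modByMonicHom_eq_zero _) hi,
      put_apply_eq_zero (fun i hi => coeff_reg_eq_zero hi) hi, hoff i hi]
  · rw [h.mk_reg_add_put, h.mk_reg_inPlace, reg_add,
      reg_put_self (fun i hi => coeff_reg_eq_zero hi), map_add, add_pow_char_pow, hreg, hely]

end IsSparseModulus
end

/-! ### Inversion by the Itoh–Tsujii chain, and division. -/

noncomputable section

/-- The element of `𝔽₂[x]/(f)` on the `m` wires from `x` on. -/
def regElem (f : (ZMod 2)[X]) (m x : ℕ) (v : ℕ → ZMod 2) : AdjoinRoot f :=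
  AdjoinRoot.mk f (reg x m v)

theorem regElem_congr {f : (ZMod 2)[X]} {m x : ℕ} {v w : ℕ → ZMod 2}
    (h : ∀ i, x ≤ i → i < x + m → v i = w i) : regElem f m x v = regElem f m x w := by
  rw [regElem, regElem, reg_congr fun i hi => h (x + i) (by omega) (by omega)]

theorem regElem_eq_zero {f : (ZMod 2)[X]} {m x : ℕ} {v : ℕ → ZMod 2}
    (h : ∀ i, x ≤ i → i < x + m → v i = 0) : regElem f m x v = 0 := by
  rw [regElem_congr (w := 0) h, regElem]
  simp [reg]

/-- For b ≠ 0 this is Fermat in a field with 2^deg f elements. Degree at least 2 makes the exponent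
positive, which the case b = 0 requires. -/
theorem AdjoinRoot.pow_two_pow_sub_two {f : (ZMod 2)[X]} [Fact (Irreducible f)] (hf : f.Monic)
    (hd : 2 ≤ f.natDegree) (b : AdjoinRoot f) : b ^ (2 ^ f.natDegree - 2) = b⁻¹ := by
  have h4 : 2 ^ 2 ≤ 2 ^ f.natDegree := Nat.pow_le_pow_right (by norm_num) hd
  by_cases hb : b = 0
  · rw [hb, inv_zero, zero_pow (by omega)]
  have hfin : Module.Finite (ZMod 2) (AdjoinRoot f) := hf.finite_adjoinRoot
  have : Finite (AdjoinRoot f) := Module.finite_of_finite (ZMod 2)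
  have := Fintype.ofFinite (AdjoinRoot f)
  have hcard : Fintype.card (AdjoinRoot f) = 2 ^ f.natDegree := by
    rw [Module.card_eq_pow_finrank (K := ZMod 2), ZMod.card, (AdjoinRoot.powerBasis' hf).finrank,
      AdjoinRoot.powerBasis'_dim]
  have h1 := FiniteField.pow_card_sub_one_eq_one b hb
  rw [hcard] at h1
  refine eq_inv_of_mul_eq_one_left ?_
  rw [← pow_succ, show 2 ^ f.natDegree - 2 + 1 = 2 ^ f.natDegree - 1 by omega, h1]

namespace IsSparseModulus

open AdjoinRoot

variable {f g : (ZMod 2)[X]} {m : ℕ} (h : IsSparseModulus f g m)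
include h

theorem regElem_add_put_self (x : ℕ) (v : ℕ → ZMod 2) (z : AdjoinRoot f) :
    regElem f m x (v + put x (modByMonicHom h.monic z)) = regElem f m x v + z :=
  h.mk_reg_add_put v z

theorem regElem_add_put_of_disjoint {x y : ℕ} (v : ℕ → ZMod 2) (z : AdjoinRoot f)
    (hxy : x + m ≤ y ∨ y + m ≤ x) :
    regElem f m x (v + put y (modByMonicHom h.monic z)) = regElem f m x v := by
  rw [regElem, h.reg_add_put_of_disjoint v z hxy, regElem]

theorem add_put_apply {y w : ℕ} (v : ℕ → ZMod 2) (z : AdjoinRoot f) (hw : w < y ∨ y + m ≤ w) :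
    (v + put y (modByMonicHom h.monic z)) w = v w := by
  rw [Pi.add_apply, put_apply_eq_zero (h.coeff_modByMonicHom_eq_zero z) hw, add_zero]

/-- The transformation `F` of the memory computes `ψ b` from the divisor `b`, into the register at
`x`, if all wires from `5 * m` on are clean.  It changes only wires between `5 * m` and `N` and does
not interfere with the target register. -/
structure Computes (N x : ℕ) (F : (ℕ → ZMod 2) → (ℕ → ZMod 2))
    (ψ : AdjoinRoot f → AdjoinRoot f) : Prop where
  apply_eq : ∀ v : ℕ → ZMod 2, ∀ w, w < 5 * m ∨ N ≤ w → F v w = v w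
  regElem_eq : ∀ v : ℕ → ZMod 2, (∀ w, 5 * m ≤ w → v w = 0) →
    regElem f m x (F v) = ψ (regElem f m m v)
  add_put : ∀ v z, F (v + put (2 * m) (modByMonicHom h.monic z))
    = F v + put (2 * m) (modByMonicHom h.monic z)

variable {h} in
/-- A fresh register is filled with a function of the divisor and of a register computed before. -/
theorem Computes.add {N x : ℕ} {F : (ℕ → ZMod 2) → (ℕ → ZMod 2)}
    {ψ : AdjoinRoot f → AdjoinRoot f} (hF : h.Computes N x F ψ) (hN : 5 * m ≤ N)
    {φ : (ℕ → ZMod 2) → AdjoinRoot f}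
    {ψ' : AdjoinRoot f → AdjoinRoot f} (hφ : ∀ v, (∀ w, 5 * m ≤ w → v w = 0) →
      φ (F v) = ψ' (regElem f m m v))
    (hread : ∀ v z, φ (v + put (2 * m) (modByMonicHom h.monic z)) = φ v) :
    h.Computes (N + m) N (fun v => F v + put N (modByMonicHom h.monic (φ (F v)))) ψ' where
  apply_eq v w hw := by
    rw [h.add_put_apply _ _ (by omega), hF.apply_eq v w (by omega)]
  regElem_eq v hv := by
    rw [h.regElem_add_put_self, hφ v hv, regElem_eq_zero, zero_add]
    intro i hi hi'
    rw [hF.apply_eq v i (by omega), hv i (by omega)]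
  add_put v z := by
    rw [hF.add_put, hread]
    abel

/-- `fr k` CNOT gates suffice for adding the `2 ^ k`-th power of a register to another one. -/
def PowCost (fr : ℕ → ℕ) : Prop :=
  ∀ k N x y : ℕ, x + m ≤ N → y + m ≤ N → (x + m ≤ y ∨ y + m ≤ x) →
    Realizes (Set.Iio N) (fun v => v + put y (modByMonicHom h.monic (regElem f m x v ^ 2 ^ k)))
      (fr k) 0

/-- `M` CNOT and `T` Toffoli gates suffice for adding the product of two registers to a third one,
with scratch space between `3 * m` and `5 * m`. -/
def MulCost (M T : ℕ) : Prop :=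
  ∀ N x y z : ℕ, x + m ≤ N → y + m ≤ N → z + m ≤ N → 5 * m ≤ N → (x + m ≤ y ∨ y + m ≤ x) →
    (x + m ≤ z ∨ z + m ≤ x) → (y + m ≤ z ∨ z + m ≤ y) → (5 * m ≤ x ∨ x + m ≤ 3 * m) →
    (5 * m ≤ y ∨ y + m ≤ 3 * m) → (5 * m ≤ z ∨ z + m ≤ 3 * m) →
    Realizes (Set.Iio N) (fun v => v + put z (modByMonicHom h.monic
      (regElem f m x v * regElem f m y v))) M T

variable {h} in
/-- One step of the addition chain of Itoh and Tsujii. -/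
theorem Computes.double {fr : ℕ → ℕ} {M T : ℕ} (hfr : h.PowCost fr) (hmul : h.MulCost M T)
    {N x e c t : ℕ} {F : (ℕ → ZMod 2) → (ℕ → ZMod 2)} (hx : 5 * m ≤ x) (hxN : x + m ≤ N)
    (hF : h.Computes N x F fun b => b ^ (2 ^ e - 1)) (hc : Realizes (Set.Iio N) F c t) :
    ∃ F', h.Computes (N + m + m) (N + m) F' (fun b => b ^ (2 ^ (e + e) - 1)) ∧
      Realizes (Set.Iio (N + m + m)) F' (c + fr e + M) (t + T) := by
  have hF1 := hF.add (φ := fun v => regElem f m x v ^ 2 ^ e)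
    (ψ' := fun b => (b ^ (2 ^ e - 1)) ^ 2 ^ e) (by omega)
    (fun v hv => by rw [hF.regElem_eq v hv])
    (fun v z => by rw [h.regElem_add_put_of_disjoint _ _ (by omega)])
  -- The exponents satisfy (2^e - 1) 2^e + (2^e - 1) = 2^(2e) - 1.
  have hF2 := hF1.add (φ := fun v => regElem f m N v * regElem f m x v)
    (ψ' := fun b => b ^ (2 ^ (e + e) - 1)) (by omega)
    (fun v hv => by
      rw [hF1.regElem_eq v hv, h.regElem_add_put_of_disjoint _ _ (by omega), hF.regElem_eq v hv,
        ← pow_mul, ← pow_add]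
      congr 1
      obtain ⟨k, hk⟩ := Nat.exists_eq_add_of_le' (Nat.one_le_two_pow (n := e))
      rw [pow_add, hk, Nat.add_sub_cancel]
      have : (k + 1) * (k + 1) = k * (k + 1) + k + 1 := by ring
      omega)
    (fun v z => by rw [h.regElem_add_put_of_disjoint _ _ (by omega),
      h.regElem_add_put_of_disjoint _ _ (by omega)])
  refine ⟨_, hF2, ?_⟩
  have h1 := hfr e (N + m + m) x N (by omega) (by omega) (by omega)
  have h2 := hmul (N + m + m) N x (N + m) (by omega) (by omega) (by omega) (by omega) (by omega)
    (by omega) (by omega) (by omega) (by omega) (by omega)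
  have h0 := hc.mono (Set.Iio_subset_Iio (show N ≤ N + m + m by omega)) le_rfl le_rfl
  exact h2.comp (h1.comp h0)

-- The step of the chain for odd exponents: one squaring and one product with b itself, read from
-- the divisor register.
variable {h} in
theorem Computes.succ {fr : ℕ → ℕ} {M T : ℕ} (hfr : h.PowCost fr) (hmul : h.MulCost M T)
    {N x e c t : ℕ} {F : (ℕ → ZMod 2) → (ℕ → ZMod 2)} (hx : 5 * m ≤ x) (hxN : x + m ≤ N)
    (hF : h.Computes N x F fun b => b ^ (2 ^ e - 1)) (hc : Realizes (Set.Iio N) F c t) :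
    ∃ F', h.Computes (N + m + m) (N + m) F' (fun b => b ^ (2 ^ (e + 1) - 1)) ∧
      Realizes (Set.Iio (N + m + m)) F' (c + fr 1 + M) (t + T) := by
  have hF1 := hF.add (φ := fun v => regElem f m x v ^ 2 ^ 1)
    (ψ' := fun b => (b ^ (2 ^ e - 1)) ^ 2 ^ 1) (by omega)
    (fun v hv => by rw [hF.regElem_eq v hv])
    (fun v z => by rw [h.regElem_add_put_of_disjoint _ _ (by omega)])
  have hF2 := hF1.add (φ := fun v => regElem f m N v * regElem f m m v)
    (ψ' := fun b => b ^ (2 ^ (e + 1) - 1)) (by omega)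
    (fun v hv => by
      rw [hF1.regElem_eq v hv, regElem_congr (w := v) (x := m)
        (fun i _ hi => hF1.apply_eq v i (by omega)), ← pow_mul, ← pow_succ]
      congr 1
      obtain ⟨k, hk⟩ := Nat.exists_eq_add_of_le' (Nat.one_le_two_pow (n := e))
      rw [pow_add, hk]
      omega)
    (fun v z => by rw [h.regElem_add_put_of_disjoint _ _ (by omega),
      h.regElem_add_put_of_disjoint _ _ (by omega)])
  refine ⟨_, hF2, ?_⟩
  have h1 := hfr 1 (N + m + m) x N (by omega) (by omega) (by omega)
  have h2 := hmul (N + m + m) N m (N + m) (by omega) (by omega) (by omega) (by omega) (by omega)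
    (by omega) (by omega) (by omega) (by omega) (by omega)
  have h0 := hc.mono (Set.Iio_subset_Iio (show N ≤ N + m + m by omega)) le_rfl le_rfl
  exact h2.comp (h1.comp h0)

/-- The base e = 1 of the chain. The identity map serves as an empty computation, whose result
register is clean and hence holds 0. -/
theorem computes_copy : ∃ F, h.Computes (5 * m + m) (5 * m) F (fun b => b ^ (2 ^ 1 - 1)) ∧
    Realizes (Set.Iio (5 * m + m)) F m 0 := by
  have hm0 : 0 < m := (Nat.zero_le _).trans_lt h.lt
  have h1 : h.Computes (5 * m) (5 * m + m) id fun _ => 0 :=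
    ⟨fun _ _ _ => rfl, fun v hv => regElem_eq_zero fun i hi _ => hv i (by omega), fun _ _ => rfl⟩
  have h2 := h1.add (φ := regElem f m m) (ψ' := fun b => b ^ (2 ^ 1 - 1)) le_rfl
    (fun v hv => by simp) (fun v z => h.regElem_add_put_of_disjoint _ _ (by omega))
  refine ⟨_, h2, (Realizes.add_reg (x := m) (y := 5 * m) m (by omega) (by omega)
    (by omega)).congr fun v => ?_⟩
  have h3 : modByMonicHom h.monic (regElem f m m v) = reg m m v := by
    refine modByMonicHom_mk_of_degree_lt h.monic ?_
    rw [h.degree_eq, degree_lt_iff_coeff_zero]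
    exact fun i hi => coeff_reg_eq_zero hi
  simp [h3]

/-- The powers `b ^ (2 ^ e - 1)` are computed with `O(log e)` multiplications. -/
theorem exists_computes_pow {fr : ℕ → ℕ} {M T : ℕ} (hfr : h.PowCost fr) (hmul : h.MulCost M T)
    (e : ℕ) (he : 1 ≤ e) : ∃ N x F, 5 * m ≤ x ∧ x + m ≤ N ∧ N ≤ (4 * Nat.log 2 e + 6) * m ∧
      h.Computes N x F (fun b => b ^ (2 ^ e - 1)) ∧
      Realizes (Set.Iio N) F (m + ∑ i ∈ Finset.range (Nat.log 2 e), fr (e / 2 ^ (i + 1)) +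
        Nat.log 2 e * (fr 1 + 2 * M)) (Nat.log 2 e * (2 * T)) := by
  induction e using Nat.strong_induction_on with
  | _ e ih =>
  rcases (show e = 1 ∨ 2 ≤ e by omega) with rfl | he2
  · obtain ⟨F, hF1, hF2⟩ := h.computes_copy
    exact ⟨_, _, F, le_rfl, le_rfl, by simp; linarith, hF1, hF2.mono le_rfl (by omega) (by omega)⟩
  · obtain ⟨N, x, F, h1, h2, h3, h4, h5⟩ := ih (e / 2) (by omega) (by omega)
    have hlog : Nat.log 2 e = Nat.log 2 (e / 2) + 1 := by
      rw [Nat.log_of_one_lt_of_le (by norm_num) he2]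
    have hsum : ∑ i ∈ Finset.range (Nat.log 2 e), fr (e / 2 ^ (i + 1))
        = ∑ i ∈ Finset.range (Nat.log 2 (e / 2)), fr (e / 2 / 2 ^ (i + 1)) + fr (e / 2) := by
      rw [hlog, Finset.sum_range_succ']
      simp only [Nat.div_div_eq_div_mul, zero_add, pow_one]
      congr 1
      refine Finset.sum_congr rfl fun i _ => ?_
      rw [pow_succ' 2 (i + 1)]
    have h6 : (4 * Nat.log 2 e + 6) * m = (4 * Nat.log 2 (e / 2) + 6) * m + 4 * m := by
      rw [hlog]; ring
    have h7 : Nat.log 2 e * (fr 1 + 2 * M)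
        = Nat.log 2 (e / 2) * (fr 1 + 2 * M) + (fr 1 + 2 * M) := by
      rw [hlog]; ring
    have h8 : Nat.log 2 e * (2 * T) = Nat.log 2 (e / 2) * (2 * T) + 2 * T := by
      rw [hlog]; ring
    rw [hsum, h6, h7, h8]
    -- Doubling, and the extra step for odd `e`, take two fresh registers each, hence at most 4m
    -- wires per halving.
    obtain ⟨F', h9, h10⟩ := h4.double hfr hmul h1 h2 h5
    rcases Nat.even_or_odd' e with ⟨k, hk | hk⟩
    · have hk' : e / 2 + e / 2 = e := by omega
      rw [hk'] at h9
      exact ⟨_, _, F', by omega, le_rfl, by omega, h9, h10.mono le_rfl (by omega) (by omega)⟩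
    · have hk' : e / 2 + e / 2 + 1 = e := by omega
      obtain ⟨F'', h11, h12⟩ := h9.succ hfr hmul (by omega) le_rfl h10
      rw [hk'] at h11
      exact ⟨_, _, F'', by omega, le_rfl, by omega, h11, h12.mono le_rfl (by omega) (by omega)⟩

/-- Division on the memory: dividend, divisor and target are the first three registers. -/
theorem exists_realizes_div [Fact (Irreducible f)] (hm : 3 ≤ m) {fr : ℕ → ℕ} {M T : ℕ}
    (hfr : h.PowCost fr) (hmul : h.MulCost M T) : ∃ N F, 5 * m ≤ N ∧
      N ≤ (4 * Nat.log 2 m + 7) * m ∧ (∀ v : ℕ → ZMod 2, (∀ w, 5 * m ≤ w → v w = 0) →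
        F v = v + put (2 * m) (modByMonicHom h.monic (regElem f m 0 v / regElem f m m v))) ∧
      Realizes (Set.Iio N) F (2 * (m + ∑ i ∈ Finset.range (Nat.log 2 (m - 1)),
        fr ((m - 1) / 2 ^ (i + 1)) + Nat.log 2 (m - 1) * (fr 1 + 2 * M) + fr 1) + M)
        (2 * (Nat.log 2 (m - 1) * (2 * T)) + T) := by
  obtain ⟨N, x, F, h1, h2, h3, h4, h5⟩ := h.exists_computes_pow hfr hmul (m - 1) (by omega)
  have hlog : Nat.log 2 (m - 1) ≤ Nat.log 2 m := Nat.log_mono_right (by omega)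
  have hN : N + m ≤ (4 * Nat.log 2 m + 7) * m := by
    have : (4 * Nat.log 2 (m - 1) + 6) * m ≤ (4 * Nat.log 2 m + 6) * m := by gcongr
    have h6 : (4 * Nat.log 2 m + 7) * m = (4 * Nat.log 2 m + 6) * m + m := by ring
    omega
  -- A last squaring turns the exponent 2^(m-1) - 1 into 2^m - 2.
  have hI := h4.add (φ := fun v => regElem f m x v ^ 2 ^ 1) (ψ' := fun b => b⁻¹) (by omega)
    (fun v hv => by
      rw [h4.regElem_eq v hv, ← pow_mul, ← AdjoinRoot.pow_two_pow_sub_two h.monic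
        (by rw [h.natDegree_eq]; omega), h.natDegree_eq]
      congr 1
      obtain ⟨k, rfl⟩ : ∃ k, m = k + 1 := ⟨m - 1, by omega⟩
      rw [Nat.add_sub_cancel, pow_succ]
      have := Nat.one_le_two_pow (n := k)
      omega)
    (fun v z => by rw [h.regElem_add_put_of_disjoint _ _ (by omega)])
  have hIr := (hfr 1 (N + m) x N (by omega) (by omega) (by omega)).comp
    (h5.mono (Set.Iio_subset_Iio (show N ≤ N + m by omega)) le_rfl le_rfl)
  set H : (ℕ → ZMod 2) → (ℕ → ZMod 2) := fun v => F v + put N (modByMonicHom h.monic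
    (regElem f m x (F v) ^ 2 ^ 1)) with hH
  -- `H` commutes with additions to the target, so running `G` after the product has been added
  -- restores every other wire and keeps the quotient.
  obtain ⟨G, hG, hG1, hG2⟩ := hIr.exists_inverse
  have hM := hmul (N + m) 0 N (2 * m) (by omega) (by omega) (by omega) (by omega) (by omega)
    (by omega) (by omega) (by omega) (by omega) (by omega)
  refine ⟨N + m, _, by omega, hN, fun v hv => ?_, (hG.comp (hM.comp hIr)).mono le_rfl ?_ ?_⟩
  · change G (H v + put (2 * m) (modByMonicHom h.monic
      (regElem f m 0 (H v) * regElem f m N (H v)))) = _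
    rw [hI.regElem_eq v hv, regElem_congr (v := H v) (w := v) (x := 0)
      (fun i _ hi => hI.apply_eq v i (by omega)), ← hI.add_put]
    exact (hG1 _).trans (by rw [div_eq_mul_inv])
  · omega
  · omega

/-- Division on the wires of a division circuit. -/
theorem exists_implementsDivision [Fact (Irreducible f)] (hm : 3 ≤ m) {fr : ℕ → ℕ} {M T : ℕ}
    (hfr : h.PowCost fr) (hmul : h.MulCost M T) : ∃ (k : ℕ) (Q : RevCircuit (DivWires m k)),
      ImplementsDivision f m k Q ∧ k ≤ (4 * Nat.log 2 m + 4) * m ∧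
      Q.cnotCount ≤ 2 * (m + ∑ i ∈ Finset.range (Nat.log 2 (m - 1)),
        fr ((m - 1) / 2 ^ (i + 1)) + Nat.log 2 (m - 1) * (fr 1 + 2 * M) + fr 1) + M ∧
      Q.toffoliCount ≤ 2 * (Nat.log 2 (m - 1) * (2 * T)) + T := by
  obtain ⟨N, F, h5N, hN, hF, Q, hQ1, hQ2, hQ3, hQ4⟩ := h.exists_realizes_div hm hfr hmul
  obtain ⟨k, rfl⟩ : ∃ k, N = 3 * m + k := ⟨N - 3 * m, by omega⟩
  have hinj : Function.Injective (Sum.elim (fun i : Fin m => (i : ℕ)) (Sum.elim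
      (fun i : Fin m => m + i) (Sum.elim (fun i : Fin m => 2 * m + i)
        fun i : Fin k => 3 * m + (i : ℕ))) : DivWires m k → ℕ) := by
    rintro (i | i | i | i) (j | j | j | j) hij <;> simp only [Sum.elim_inl, Sum.elim_inr] at hij <;>
      first
      | (congr; ext; omega)
      | (have := i.2; have := j.2; omega)
  set e : DivWires m k ↪ ℕ := ⟨_, hinj⟩ with he
  have hrange : ∀ w < 3 * m + k, w ∈ Set.range e := by
    intro w hw
    rcases (show w < m ∨ (m ≤ w ∧ w < 2 * m) ∨ (2 * m ≤ w ∧ w < 3 * m) ∨ 3 * m ≤ w by omega) with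
      h1 | ⟨h1, h2⟩ | ⟨h1, h2⟩ | h1
    · exact ⟨Sum.inl ⟨w, h1⟩, rfl⟩
    · exact ⟨Sum.inr (Sum.inl ⟨w - m, by omega⟩), Nat.add_sub_of_le h1⟩
    · exact ⟨Sum.inr (Sum.inr (Sum.inl ⟨w - 2 * m, by omega⟩)), Nat.add_sub_of_le h1⟩
    · exact ⟨Sum.inr (Sum.inr (Sum.inr ⟨w - 3 * m, by omega⟩)), Nat.add_sub_of_le h1⟩
  -- All wires used lie below 3m + k, hence in the range of `e`, and the circuit can be pulled back.
  obtain ⟨Q', rfl⟩ := RevCircuit.exists_map_eq e Q fun g hg =>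
    (hQ1 g hg).mono fun w hw => hrange w hw
  rw [RevCircuit.cnotCount_map] at hQ3
  rw [RevCircuit.toffoliCount_map] at hQ4
  refine ⟨k, Q', ?_, ?_, hQ3, hQ4⟩
  · intro a b c
    set v : ℕ → ZMod 2 := Function.extend e (divState k a b c) 0 with hv
    have hve : ∀ w, v (e w) = divState k a b c w := fun w => hinj.extend_apply _ _ w
    have hclean : ∀ w, 3 * m ≤ w → v w = 0 := by
      intro w hw
      by_cases hwk : w < 3 * m + k
      · have := hve (Sum.inr (Sum.inr (Sum.inr ⟨w - 3 * m, by omega⟩)))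
        rwa [show e (Sum.inr (Sum.inr (Sum.inr ⟨w - 3 * m, by omega⟩))) = w from
          Nat.add_sub_of_le hw] at this
      · refine Function.extend_apply' _ _ _ ?_
        rintro ⟨i | i | i | i, rfl⟩ <;> have := i.2 <;>
          simp only [he, Function.Embedding.coeFn_mk, Sum.elim_inl, Sum.elim_inr] at hw hwk <;> omega
    have hfe : ∀ (x : ℕ) (u : Fin m → ZMod 2) (v : ℕ → ZMod 2), (∀ i : Fin m, v (x + i) = u i) →
        fieldElem f u = regElem f m x v := by
      intro x u v hu
      rw [fieldElem_eq_mk, regElem, reg, Finset.sum_range]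
      simp only [hu]
    have h1 : RevCircuit.eval (Q'.map (RevGate.map e)) v = _ :=
      (hQ2 v).trans (hF v fun w hw => hclean w (by omega))
    have h2 : ∀ w, RevCircuit.eval Q' (divState k a b c) w
        = (v + put (2 * m) (modByMonicHom h.monic (regElem f m 0 v / regElem f m m v))) (e w) := by
      intro w
      rw [← h1, RevCircuit.eval_map_apply]
      congr 1
      funext w
      exact (hve w).symm
    refine ⟨fun i => RevCircuit.eval Q' (divState k a b c) (Sum.inr (Sum.inr (Sum.inl i))), ?_, ?_⟩
    · rw [hfe (2 * m) _ _ fun i => (h2 (Sum.inr (Sum.inr (Sum.inl i)))).symm,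
        h.regElem_add_put_self, hfe 0 a v fun i => by
          rw [zero_add]; exact hve (Sum.inl i),
        hfe m b v fun i => hve (Sum.inr (Sum.inl i)),
        hfe (2 * m) c v fun i => hve (Sum.inr (Sum.inr (Sum.inl i)))]
    · funext w
      rcases w with i | i | i | i
      · rw [h2, h.add_put_apply _ _ (Or.inl ?_), hve]
        · rfl
        · have := i.2
          change (i : ℕ) < _
          omega
      · rw [h2, h.add_put_apply _ _ (Or.inl ?_), hve]
        · rfl
        · have := i.2
          change m + (i : ℕ) < _
          omega
      · rfl
      · rw [h2, h.add_put_apply _ _ (Or.inr ?_), hve]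
        · rfl
        · change _ ≤ 3 * m + (i : ℕ)
          omega
  · have : (4 * Nat.log 2 m + 7) * m = (4 * Nat.log 2 m + 4) * m + 3 * m := by ring
    omega

theorem mulCost {r : ℕ} (hr : m ≤ 2 ^ r) :
    h.MulCost (24 * 3 ^ r + 4 * m * (6 * g.natDegree + 5)) (2 * 3 ^ r) := by
  intro N x y z hx hy hz hN hxy hxz hyz h3x h3y h3z
  exact h.realizes_add_mul (t := 3 * m) hr hx hy hz (by omega) hxy hxz hyz (by omega) (by omega)
    (by omega)

/-- Repeated squaring is cheap for small k, while the four Russians bound does not depend on k.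
Taking the minimum keeps the sum over the chain small. -/
theorem powCost [Fact (Irreducible f)] {s : ℕ} (hs : 0 < s) :
    h.PowCost fun k => min (2 * (k * ((5 * (4 * g.natDegree + 2) + 7) * m)) + m)
      ((m / s + 1) * (2 * s * 2 ^ s + m)) := by
  intro k N x y hx hy hxy
  rcases min_choice (2 * (k * ((5 * (4 * g.natDegree + 2) + 7) * m)) + m)
    ((m / s + 1) * (2 * s * 2 ^ s + m)) with h1 | h1
  · simp only [h1]
    exact h.realizes_add_pow k hx hy hxy
  · simp only [h1]
    exact (h.realizes_add_map (iterateFrobenius (AdjoinRoot f) 2 k : AdjoinRoot f →+ AdjoinRoot f)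
      hs hx hy hxy).congr fun v => rfl

end IsSparseModulus
end

/-! ### Real estimates for the gate counts. -/

noncomputable section

theorem Real.one_le_log_of_three_le {x : ℝ} (hx : 3 ≤ x) : 1 ≤ Real.log x := by
  rw [Real.le_log_iff_exp_le (by linarith)]
  linarith [Real.exp_one_lt_d9]

theorem Real.log_pow_three_le {x : ℝ} (hx : 3 ≤ x) : Real.log x ^ 3 ≤ 27 * x := by
  have h1 : 0 ≤ Real.log x := by linarith [Real.one_le_log_of_three_le hx]
  have h2 := Real.log_le_rpow_div (x := x) (by linarith) (ε := 1 / 3) (by norm_num)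
  calc Real.log x ^ 3 ≤ (x ^ (1 / 3 : ℝ) / (1 / 3)) ^ 3 := by gcongr
    _ = 27 * (x ^ (1 / 3 : ℝ)) ^ 3 := by ring
    _ = 27 * x := by rw [← Real.rpow_natCast, ← Real.rpow_mul (by linarith)]; norm_num

theorem Real.log_sq_le {x : ℝ} (hx : 3 ≤ x) : Real.log x ^ 2 ≤ 4 * x := by
  have h1 : 0 ≤ Real.log x := by linarith [Real.one_le_log_of_three_le hx]
  have h2 := Real.log_le_rpow_div (x := x) (by linarith) (ε := 1 / 2) (by norm_num)
  calc Real.log x ^ 2 ≤ (x ^ (1 / 2 : ℝ) / (1 / 2)) ^ 2 := by gcongr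
    _ = 4 * (x ^ (1 / 2 : ℝ)) ^ 2 := by ring
    _ = 4 * x := by rw [← Real.rpow_natCast, ← Real.rpow_mul (by linarith)]; norm_num

theorem Real.logb_two_three_le : Real.logb 2 3 ≤ 8 / 5 := by
  rw [Real.logb_le_iff_le_rpow (by norm_num) (by norm_num)]
  -- The inequality amounts to 3^5 = 243 ≤ 256 = 2^8.
  refine le_of_pow_le_pow_left₀ (n := 5) (by norm_num) (by positivity) ?_
  rw [← Real.rpow_natCast (2 ^ (8 / 5 : ℝ)), ← Real.rpow_mul (by norm_num)]
  norm_num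

/-- The gap 2 - 8/5 = 2/5 in the exponent absorbs two logarithms. Hence log m Karatsuba products
stay below the order m²/log m. -/
theorem Real.log_sq_mul_rpow_le {x : ℝ} (hx : 3 ≤ x) :
    Real.log x ^ 2 * x ^ Real.logb 2 3 ≤ 25 * x ^ 2 := by
  have h1 : 0 ≤ Real.log x := by linarith [Real.one_le_log_of_three_le hx]
  have hx0 : 0 < x := by linarith
  have h2 := Real.log_le_rpow_div (x := x) (by linarith) (ε := 1 / 5) (by norm_num)
  calc Real.log x ^ 2 * x ^ Real.logb 2 3 ≤ (x ^ (1 / 5 : ℝ) / (1 / 5)) ^ 2 * x ^ (8 / 5 : ℝ) := by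
        gcongr
        · linarith
        · exact Real.logb_two_three_le
    _ = 25 * ((x ^ (1 / 5 : ℝ)) ^ (2 : ℕ) * x ^ (8 / 5 : ℝ)) := by ring
    _ = 25 * x ^ 2 := by
        rw [← Real.rpow_natCast, ← Real.rpow_mul hx0.le, ← Real.rpow_add hx0]
        norm_num

/-- Rounding m up to a power of two at most doubles it, and 2^(log₂ 3) = 3. -/
theorem three_pow_clog_le {m : ℕ} (hm : 3 ≤ m) :
    (3 : ℝ) ^ Nat.clog 2 m ≤ 3 * (m : ℝ) ^ Real.logb 2 3 := by
  have h1 : (2 : ℝ) ^ Nat.clog 2 m ≤ 2 * m := by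
    have h2 := Nat.pow_pred_clog_lt_self (b := 2) (x := m) (by norm_num) (by omega)
    have h3 : 0 < Nat.clog 2 m := Nat.clog_pos (by norm_num) (by omega)
    have h4 : 2 ^ Nat.clog 2 m = 2 * 2 ^ (Nat.clog 2 m).pred := by
      rw [← pow_succ', Nat.pred_eq_sub_one, Nat.sub_add_cancel h3]
    exact_mod_cast (show 2 ^ Nat.clog 2 m ≤ 2 * m by omega)
  have h5 : (2 : ℝ) ^ Real.logb 2 3 = 3 := Real.rpow_logb (by norm_num) (by norm_num) (by norm_num)
  have h6 : 0 ≤ Real.logb 2 3 := Real.logb_nonneg (by norm_num) (by norm_num)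
  calc (3 : ℝ) ^ Nat.clog 2 m = ((2 : ℝ) ^ Nat.clog 2 m) ^ Real.logb 2 3 := by
        rw [← Real.rpow_natCast, ← Real.rpow_natCast, ← Real.rpow_mul (by norm_num), mul_comm,
          Real.rpow_mul (by norm_num), h5]
    _ ≤ (2 * (m : ℝ)) ^ Real.logb 2 3 := by gcongr
    _ = 3 * (m : ℝ) ^ Real.logb 2 3 := by rw [Real.mul_rpow (by norm_num) (by positivity), h5]

theorem natLog_two_le {m : ℕ} (hm : 3 ≤ m) : (Nat.log 2 m : ℝ) ≤ 2 * Real.log m := by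
  have hL := Real.one_le_log_of_three_le (x := (m : ℝ)) (by exact_mod_cast hm)
  have h1 := Real.natLog_le_logb m 2
  rw [Real.logb, Nat.cast_ofNat] at h1
  refine h1.trans ?_
  have h2 := Real.log_two_gt_d9
  rw [div_le_iff₀ (by linarith)]
  nlinarith

/-- The cost of the method of the four Russians with blocks of half the logarithm. -/
theorem fourRussians_cost_le {m : ℕ} (hm : 3 ≤ m) :
    (((m / (Nat.log 2 m / 2 + 1) + 1) *
      (2 * (Nat.log 2 m / 2 + 1) * 2 ^ (Nat.log 2 m / 2 + 1) + m) : ℕ) : ℝ)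
      ≤ 20 * ((m : ℝ) ^ 2 / Real.log m) := by
  have hx : (3 : ℝ) ≤ m := by exact_mod_cast hm
  have hL := Real.one_le_log_of_three_le hx
  have hsq := Real.log_sq_le hx
  -- This block size gives 2^s ≤ 2√m, which makes the gathering of parities affordable, while s ≥
  -- (log m)/2 keeps m²/s of order m²/log m.
  set s := Nat.log 2 m / 2 + 1 with hs
  set L := Real.log m with hLdef
  have hsm : s ≤ m := by
    have := Nat.log_lt_self 2 (x := m) (by omega)
    omega
  have hs0 : (0 : ℝ) < s := by positivity
  have hsL : L ≤ 2 * s := by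
    have h1 : m < 2 ^ (2 * s) :=
      (Nat.lt_pow_succ_log_self (b := 2) (by norm_num) m).trans_le
        (Nat.pow_le_pow_right (by norm_num) (by omega))
    have h2 : L ≤ Real.log ((2 : ℝ) ^ (2 * s)) :=
      Real.log_le_log (by linarith) (by exact_mod_cast h1.le)
    rw [Real.log_pow] at h2
    have h3 := Real.log_two_lt_d9
    push_cast at h2
    nlinarith
  have hpow : ((2 : ℝ) ^ s) ^ 2 ≤ 4 * m := by
    have h1 : 2 ^ Nat.log 2 m ≤ m := Nat.pow_log_le_self 2 (by omega)
    have h2 : (2 ^ s) ^ 2 ≤ 2 ^ (Nat.log 2 m + 2) := by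
      rw [← pow_mul]
      exact Nat.pow_le_pow_right (by norm_num) (by omega)
    have h3 : (2 ^ s) ^ 2 ≤ 4 * m := by
      have h4 := pow_add 2 (Nat.log 2 m) 2
      linarith
    exact_mod_cast h3
  have hpL : (2 : ℝ) ^ s * L ≤ 4 * m := by
    refine le_of_pow_le_pow_left₀ (n := 2) (by norm_num) (by positivity) ?_
    calc ((2 : ℝ) ^ s * L) ^ 2 = ((2 : ℝ) ^ s) ^ 2 * L ^ 2 := by ring
      _ ≤ (4 * (m : ℝ)) * (4 * m) := by gcongr
      _ = (4 * (m : ℝ)) ^ 2 := by ring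
  have hdiv : ((m / s : ℕ) : ℝ) + 1 ≤ 2 * m / s := by
    have h1 : ((m / s : ℕ) : ℝ) ≤ m / s := Nat.cast_div_le
    have h2 : (1 : ℝ) ≤ m / s := by
      rw [le_div_iff₀ hs0, one_mul]
      exact_mod_cast hsm
    have h3 : 2 * (m : ℝ) / s = m / s + m / s := by ring
    linarith
  push_cast
  calc (((m / s : ℕ) : ℝ) + 1) * (2 * s * 2 ^ s + m)
      ≤ 2 * m / s * (2 * s * 2 ^ s + m) := by gcongr
    _ = 4 * m * 2 ^ s + 2 * m ^ 2 / s := by field_simp; ring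
    _ ≤ 16 * ((m : ℝ) ^ 2 / L) + 4 * ((m : ℝ) ^ 2 / L) := by
        refine add_le_add ?_ ?_
        · rw [mul_div_assoc', le_div_iff₀ (by linarith)]
          nlinarith
        · rw [mul_div_assoc', div_le_div_iff₀ hs0 (by linarith)]
          nlinarith [sq_nonneg (m : ℝ)]
    _ = _ := by ring

/-- The first `i₀` terms are bounded by B and all later ones by the geometric bound. -/
theorem sum_min_div_two_pow_le {A B D : ℝ} (hA : 0 ≤ A) (n i₀ : ℕ)
    (t : ℕ → ℝ) (ht0 : ∀ i, 0 ≤ t i) (ht1 : ∀ i, t i ≤ B) (ht2 : ∀ i, t i ≤ A / 2 ^ (i + 1) + D) :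
    ∑ i ∈ Finset.range n, t i ≤ i₀ * B + (A / 2 ^ i₀ + n * D) := by
  calc ∑ i ∈ Finset.range n, t i ≤ ∑ i ∈ Finset.range (i₀ + n), t i :=
        Finset.sum_le_sum_of_subset_of_nonneg (Finset.range_mono (by omega)) fun i _ _ => ht0 i
    _ = ∑ i ∈ Finset.range i₀, t i + ∑ j ∈ Finset.range n, t (i₀ + j) :=
        Finset.sum_range_add t i₀ n
    _ ≤ ∑ _i ∈ Finset.range i₀, B + ∑ j ∈ Finset.range n, (A / 2 ^ i₀ / 2 * (1 / 2) ^ j + D) := by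
        gcongr with i hi j hj
        · exact ht1 i
        · refine (ht2 (i₀ + j)).trans (le_of_eq ?_)
          rw [pow_succ, pow_add, one_div, inv_pow]
          field_simp
    _ = i₀ * B + (A / 2 ^ i₀ / 2 * ∑ j ∈ Finset.range n, (1 / 2 : ℝ) ^ j + n * D) := by
        rw [Finset.sum_add_distrib, ← Finset.mul_sum]
        simp
    _ ≤ i₀ * B + (A / 2 ^ i₀ / 2 * 2 + n * D) := by
        gcongr
        exact sum_geometric_two_le n
    _ = _ := by ring

theorem pow_cost_sum_le {m d : ℕ} {K : ℝ} (hm : 3 ≤ m) (hd : (d : ℝ) ≤ K * Real.log m)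
    {B : ℕ} (hB : (B : ℝ) ≤ 20 * ((m : ℝ) ^ 2 / Real.log m)) :
    ((∑ i ∈ Finset.range (Nat.log 2 (m - 1)),
      min (2 * ((m - 1) / 2 ^ (i + 1) * ((5 * (4 * d + 2) + 7) * m)) + m) B : ℕ) : ℝ)
      ≤ (40 * K + 62 + 60 * Real.log (Real.log m)) * ((m : ℝ) ^ 2 / Real.log m) := by
  have hx : (3 : ℝ) ≤ m := by exact_mod_cast hm
  have hL := Real.one_le_log_of_three_le hx
  have hsq := Real.log_sq_le hx
  have hn : (Nat.log 2 (m - 1) : ℝ) ≤ 2 * Real.log m := by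
    refine le_trans ?_ (natLog_two_le hm)
    exact_mod_cast Nat.log_mono_right (by omega)
  set L := Real.log m with hLdef
  set ℓ := Real.log L with hl
  have hl0 : 0 ≤ ℓ := Real.log_nonneg hL
  set X := (m : ℝ) ^ 2 / L with hX
  have hX0 : 0 ≤ X := by positivity
  set A : ℝ := 2 * m * ((20 * d + 17) * m) with hA
  -- The crossover is i₀ = ⌈2 log₂ log m⌉. Dividing A, of order m² log m, by 2^i₀ ≥ (log m)² leaves
  -- m²/log m; the factor 3 bounds 2/log 2.
  obtain ⟨i₀, hi₀, hi₀'⟩ : ∃ i₀ : ℕ, L ^ 2 ≤ 2 ^ i₀ ∧ (i₀ : ℝ) ≤ 3 * ℓ + 1 := by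
    refine ⟨⌈Real.logb 2 (L ^ 2)⌉₊, ?_, ?_⟩
    · rw [← Real.rpow_natCast 2, ← Real.logb_le_iff_le_rpow (by norm_num) (by positivity)]
      exact Nat.le_ceil _
    · refine (Nat.ceil_lt_add_one (Real.logb_nonneg (by norm_num) (by nlinarith))).le.trans ?_
      gcongr
      rw [Real.logb, Real.log_pow, div_le_iff₀ (by linarith [Real.log_two_gt_d9])]
      push_cast
      nlinarith [Real.log_two_gt_d9]
  have hsum := sum_min_div_two_pow_le (A := A) (B := 20 * X) (D := m) (by positivity)
    (Nat.log 2 (m - 1)) i₀ (fun i => ((min (2 * ((m - 1) / 2 ^ (i + 1) *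
      ((5 * (4 * d + 2) + 7) * m)) + m) B : ℕ) : ℝ)) (fun i => Nat.cast_nonneg _)
    (fun i => le_trans (by exact_mod_cast min_le_right _ _) hB) (fun i => by
      refine le_trans (Nat.cast_le.2 (min_le_left _ _)) ?_
      have h1 : (((m - 1) / 2 ^ (i + 1) : ℕ) : ℝ) ≤ m / 2 ^ (i + 1) := by
        refine Nat.cast_div_le.trans ?_
        push_cast
        gcongr
        exact_mod_cast Nat.sub_le m 1
      push_cast
      calc 2 * ((((m - 1) / 2 ^ (i + 1) : ℕ) : ℝ) * ((5 * (4 * d + 2) + 7) * m)) + m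
          ≤ 2 * (m / 2 ^ (i + 1) * ((5 * (4 * d + 2) + 7) * m)) + m := by gcongr
        _ = A / 2 ^ (i + 1) + m := by rw [hA]; ring)
  rw [Nat.cast_sum]
  refine hsum.trans ?_
  have h1 : A / 2 ^ i₀ ≤ (40 * K + 34) * X := by
    calc A / 2 ^ i₀ ≤ A / L ^ 2 := by gcongr
      _ ≤ 2 * m * ((20 * (K * L) + 17 * L) * m) / L ^ 2 := by
          rw [hA]
          gcongr
          linarith
      _ = (40 * K + 34) * X := by
          rw [hX]
          field_simp
          ring
  have h2 : Nat.log 2 (m - 1) * (m : ℝ) ≤ 8 * X := by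
    calc Nat.log 2 (m - 1) * (m : ℝ) ≤ 2 * L * m := by gcongr
      _ ≤ 8 * X := by
        rw [hX, mul_div_assoc', le_div_iff₀ (by linarith)]
        nlinarith
  have h3 : i₀ * (20 * X) ≤ (3 * ℓ + 1) * (20 * X) := by gcongr
  linarith

end

/-- Only the sum `S` of the Frobenius costs carries the factor log log m; everything else is
O(m²/log m). -/
theorem division_cnot_le {m d : ℕ} {K : ℝ} (hm : 3 ≤ m) (hK : 0 ≤ K)
    (hd : (d : ℝ) ≤ K * Real.log m) {S n F M : ℕ}
    (hS : (S : ℝ) ≤ (40 * K + 62 + 60 * Real.log (Real.log m)) * ((m : ℝ) ^ 2 / Real.log m))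
    (hn : (n : ℝ) ≤ 2 * Real.log m) (hF : F ≤ 2 * ((5 * (4 * d + 2) + 7) * m) + m)
    (hM : M = 24 * 3 ^ Nat.clog 2 m + 4 * m * (6 * d + 5)) :
    ((2 * (m + S + n * (F + 2 * M) + F) + M : ℕ) : ℝ) ≤
      (25000 + 10000 * K + 120 * Real.log (Real.log m)) * ((m : ℝ) ^ 2 / Real.log m) := by
  have hx : (3 : ℝ) ≤ m := by exact_mod_cast hm
  have hL := Real.one_le_log_of_three_le hx
  have hsq := Real.log_sq_le hx
  have hcube := Real.log_pow_three_le hx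
  have hpow := Real.log_sq_mul_rpow_le hx
  have h3 := three_pow_clog_le hm
  set L := Real.log m with hLdef
  set P := (m : ℝ) ^ Real.logb 2 3 with hP
  set X := (m : ℝ) ^ 2 / L with hX
  have hP0 : 0 ≤ P := by positivity
  have hX0 : 0 ≤ X := by positivity
  have hmL : m * L ≤ 4 * X := by
    rw [hX, mul_div_assoc', le_div_iff₀ (by linarith)]
    nlinarith
  have hmL2 : m * L ^ 2 ≤ 27 * X := by
    rw [hX, mul_div_assoc', le_div_iff₀ (by linarith)]
    nlinarith
  have hLP : L * P ≤ 25 * X := by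
    rw [hX, mul_div_assoc', le_div_iff₀ (by linarith)]
    linarith
  have hmX : (m : ℝ) ≤ 4 * X := by nlinarith
  have hPX : P ≤ 25 * X := by nlinarith
  have hF' : (F : ℝ) ≤ (40 * K + 35) * (m * L) := by
    have h1 : (F : ℝ) ≤ 2 * ((5 * (4 * d + 2) + 7) * m) + m := by exact_mod_cast hF
    have h2 : (d : ℝ) * m ≤ K * L * m := by gcongr
    nlinarith
  have hM' : (M : ℝ) ≤ 72 * P + (24 * K + 20) * (m * L) := by
    rw [hM]
    push_cast
    have h2 : (d : ℝ) * m ≤ K * L * m := by gcongr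
    nlinarith
  have hnF : (n : ℝ) * F ≤ 54 * (40 * K + 35) * X := by
    calc (n : ℝ) * F ≤ (2 * L) * ((40 * K + 35) * (m * L)) := by gcongr
      _ = 2 * (40 * K + 35) * (m * L ^ 2) := by ring
      _ ≤ 2 * (40 * K + 35) * (27 * X) := by gcongr
      _ = _ := by ring
  have hnM : (n : ℝ) * M ≤ (3600 + 54 * (24 * K + 20)) * X := by
    calc (n : ℝ) * M ≤ (2 * L) * (72 * P + (24 * K + 20) * (m * L)) := by gcongr
      _ = 144 * (L * P) + 2 * (24 * K + 20) * (m * L ^ 2) := by ring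
      _ ≤ 144 * (25 * X) + 2 * (24 * K + 20) * (27 * X) := by gcongr
      _ = _ := by ring
  have hFX : (F : ℝ) ≤ (40 * K + 35) * (4 * X) := hF'.trans (by gcongr)
  have hMX : (M : ℝ) ≤ 72 * (25 * X) + (24 * K + 20) * (4 * X) := hM'.trans (by gcongr)
  have hKX : 0 ≤ K * X := by positivity
  push_cast
  linarith

/-! ### Assembly of the three bounds with one constant. -/

theorem mainTheorem6 (K : ℝ) :
    ∃ C : ℝ, ∀ (m : ℕ) (f g : (ZMod 2)[X]), 3 ≤ m → f = X ^ m + g →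
      g.natDegree < m → (g.natDegree : ℝ) ≤ K * Real.log m →
      ∀ [Fact (Irreducible f)],
        (∃ Q : RevCircuit (Fin m),
          CnotImplements f m (fun a => (1 + AdjoinRoot.root f ^ ⌈(m : ℚ) / 2⌉₊) * a) Q ∧
          (Q.cnotCount : ℝ) ≤ C * (m * Real.log m)) ∧
        (∃ Q : RevCircuit (Fin m),
          CnotImplements f m (fun a => a ^ 2) Q ∧
          (Q.cnotCount : ℝ) ≤ C * (m * Real.log m)) ∧
        (∃ (k : ℕ) (Q : RevCircuit (DivWires m k)),
          ImplementsDivision f m k Q ∧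
          (Q.cnotCount : ℝ) ≤ C * ((m : ℝ) ^ 2 * Real.log (Real.log m) / Real.log m) ∧
          (Q.toffoliCount : ℝ) ≤ C * ((m : ℝ) ^ Real.logb 2 3 * Real.log m) ∧
          (k : ℝ) ≤ C * (m * Real.log m)) := by
  set c₀ := Real.log (Real.log 3) with hc₀
  have hlog3 : 1 < Real.log 3 := by
    rw [Real.lt_log_iff_exp_lt (by norm_num)]
    linarith [Real.exp_one_lt_d9]
  have hc₀pos : 0 < c₀ := Real.log_pos hlog3
  set A := 25000 + 10000 * |K| with hA
  have hK0 : 0 ≤ |K| := abs_nonneg K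
  have hA0 : 0 ≤ A := by positivity
  -- For m ≥ 3 one has log log m ≥ c₀ > 0, so A ≤ (A / c₀) log log m absorbs the terms without this
  -- factor; 120 is its coefficient in `division_cnot_le`. Replacing K by |K| keeps all bounds
  -- nonnegative.
  refine ⟨A + A / c₀ + 120, fun m f g hm hf hg hd _ => ?_⟩
  have h : IsSparseModulus f g m := ⟨hf, hg⟩
  have hx : (3 : ℝ) ≤ m := by exact_mod_cast hm
  have hL := Real.one_le_log_of_three_le hx
  have hd' : (g.natDegree : ℝ) ≤ |K| * Real.log m :=
    hd.trans (by gcongr; exact le_abs_self K)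
  have hℓ : c₀ ≤ Real.log (Real.log m) :=
    Real.log_le_log (by linarith) (Real.log_le_log (by norm_num) hx)
  have hAc : 0 ≤ A / c₀ := by positivity
  set L := Real.log m with hLdef
  have hlin : ∀ a b : ℝ, ∀ q : ℕ, a ≤ 200 → b ≤ 50 → (q : ℝ) ≤ (b * g.natDegree + a) * m →
      0 ≤ b → 0 ≤ a → (q : ℝ) ≤ (A + A / c₀ + 120) * (m * L) := by
    intro a b q ha hb hq hb0 ha0
    calc (q : ℝ) ≤ (b * g.natDegree + a) * m := hq
      _ ≤ (50 * (|K| * L) + 200 * L) * m := by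
          gcongr
          nlinarith
      _ = (50 * |K| + 200) * (m * L) := by ring
      _ ≤ _ := mul_le_mul_of_nonneg_right (by linarith) (by positivity)
  refine ⟨?_, ?_, ?_⟩
  · have hs1 : (m : ℚ) / 2 ≤ ⌈(m : ℚ) / 2⌉₊ := Nat.le_ceil _
    have hs2 : (⌈(m : ℚ) / 2⌉₊ : ℚ) < m / 2 + 1 := Nat.ceil_lt_add_one (by positivity)
    set s := ⌈(m : ℚ) / 2⌉₊ with hs
    have hs1' : m ≤ 2 * s := by
      have : (m : ℚ) ≤ 2 * s := by linarith
      exact_mod_cast this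
    have hs2' : 2 * s < m + 2 := by
      have : (2 * s : ℚ) < m + 2 := by linarith
      exact_mod_cast this
    obtain ⟨Q, hQ1, hQ2⟩ := (h.realizes_mulOneAdd (s := s) (by omega) (by omega)
      (by omega)).exists_cnotImplements
        (fun v => AdjoinRoot.fieldElem_powMatrix_mulVec h.monic _ h.natDegree_eq v)
    refine ⟨Q, hQ1, hlin 49 40 _ (by norm_num) (by norm_num) ?_ (by norm_num) (by norm_num)⟩
    refine (Nat.cast_le.2 hQ2).trans (le_of_eq ?_)
    push_cast
    ring
  · obtain ⟨Q, hQ1, hQ2⟩ := h.realizes_frobenius.exists_cnotImplements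
      (fun v => AdjoinRoot.fieldElem_powMatrix_mulVec h.monic _ h.natDegree_eq v)
    refine ⟨Q, hQ1, hlin 17 20 _ (by norm_num) (by norm_num) ?_ (by norm_num) (by norm_num)⟩
    refine (Nat.cast_le.2 hQ2).trans (le_of_eq ?_)
    push_cast
    ring
  · have hn : (Nat.log 2 (m - 1) : ℝ) ≤ 2 * L := by
      refine le_trans ?_ (natLog_two_le hm)
      exact_mod_cast Nat.log_mono_right (by omega)
    obtain ⟨k, Q, hQ, hk, hc, ht⟩ := h.exists_implementsDivision hm
      (h.powCost (s := Nat.log 2 m / 2 + 1) (by omega))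
      (h.mulCost (Nat.le_pow_clog (by norm_num) m))
    refine ⟨k, Q, hQ, ?_, ?_, ?_⟩
    · have h1 := division_cnot_le hm hK0 hd' (pow_cost_sum_le hm hd' (fourRussians_cost_le hm)) hn
        (F := min (2 * (1 * ((5 * (4 * g.natDegree + 2) + 7) * m)) + m)
          ((m / (Nat.log 2 m / 2 + 1) + 1) *
            (2 * (Nat.log 2 m / 2 + 1) * 2 ^ (Nat.log 2 m / 2 + 1) + m)))
        ((min_le_left _ _).trans_eq (by rw [one_mul])) rfl
      refine (Nat.cast_le.2 hc).trans (h1.trans ?_)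
      set ℓ := Real.log L with hl
      calc (25000 + 10000 * |K| + 120 * ℓ) * ((m : ℝ) ^ 2 / L)
          ≤ (A + A / c₀ + 120) * ℓ * ((m : ℝ) ^ 2 / L) := by
            gcongr
            have h2 : A ≤ A / c₀ * ℓ := by
              rw [div_mul_eq_mul_div, le_div_iff₀ hc₀pos]
              gcongr
            nlinarith
        _ = _ := by ring
    · have h3 := three_pow_clog_le hm
      set P := (m : ℝ) ^ Real.logb 2 3 with hP
      have hP0 : 0 ≤ P := by positivity
      calc (Q.toffoliCount : ℝ)
          ≤ ((2 * (Nat.log 2 (m - 1) * (2 * (2 * 3 ^ Nat.clog 2 m))) + 2 * 3 ^ Nat.clog 2 m : ℕ) : ℝ) :=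
            Nat.cast_le.2 ht
        _ = 8 * Nat.log 2 (m - 1) * 3 ^ Nat.clog 2 m + 2 * 3 ^ Nat.clog 2 m := by
            push_cast
            ring
        _ ≤ 8 * (2 * L) * (3 * P) + 2 * (3 * P) := by gcongr
        _ ≤ 54 * (P * L) := by nlinarith
        _ ≤ _ := by
            gcongr
            linarith
    · have h1 := natLog_two_le hm
      calc (k : ℝ) ≤ (((4 * Nat.log 2 m + 4) * m : ℕ) : ℝ) := Nat.cast_le.2 hk
        _ = (4 * Nat.log 2 m + 4) * m := by push_cast; ring
        _ ≤ (4 * (2 * L) + 4 * L) * m := by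
            gcongr
            linarith
        _ = 12 * (m * L) := by ring
        _ ≤ _ := by
            gcongr
            linarith
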